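/- **Setting.** Let $Q$ be a smooth finite-dimensional manifold, $L:TQ\to\mathbb R$ a smooth regular Lagrangian (the fibre Hessian $\partial^2L/\partial v^i\partial v^j$ is everywhere nondegenerate) and $F:TQ\to T^*Q$ a smooth fibre-preserving map (external force). Let $R:TQ\to Q$ be a retraction (smooth, $R_q(0_q)=q$, $T_{0_q}R_q=\mathrm{id}$) and let $(q,Q)\mapsto(q,\tau(q,Q))$ be the local inverse of $\sigma(v_q)=(q,R(v_q))$, mapping an open neighbourhood $U$ of the diagonal of $Q\times Q$ onto a neighbourhood of the zero section. On $TQ\times TQ\cong T(Q\times Q)$ put $$\widetilde K_F(v_q,V_Q)=\tfrac12\langle F(V_Q),\tau(Q,q)\rangle-\tfrac12\langle F(v_q),\tau(q,Q)\rangle,\qquad \mathbf L_{\widetilde K_F}(v_q,V_Q)=L(V_Q)-L(v_q)-\widetilde K_F(v_q,V_Q).$$ Fix $h>0$. Let $W\subseteq Q\times Q$ be an open set of endpoints such that for $(q_0,q_1)\in W$ there is a unique solution $q_{0,1}(t)$, $t\in[0,h]$, of the forced Euler–Lagrange equations $\frac{d}{dt}\frac{\partial L}{\partial v}-\frac{\partial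 L}{\partial q}=F$ with $q_{0,1}(0)=q_0$, $q_{0,1}(h)=q_1$, depending in a $C^2$ way on $(q_0,q_1,t)$; uniqueness is among solutions whose velocities stay in a given open set $O\subseteq TQ$. Likewise let $W_2$ be an open set of endpoints $((q_0,Q_0),(q_1,Q_1))$, containing $((q_0,q_0),(q_1,q_1))$ for all $(q_0,q_1)\in W$, for which there is a unique solution $(q(t),Q(t))$ of the (free) Euler–Lagrange equations of $\mathbf L_{\widetilde K_F}$ on $[0,h]$ with these endpoints, depending in a $C^2$ way on the endpoints and $t$; uniqueness is among solutions with velocities in an open set $O_2\subseteq TQ\times TQ$ that contains $(v,v)$ for $v\in O$ and lies over pairs with $(q,Q),(Q,q)\in U$. The Marsden–West exact forced discrete Lagrangian of $(L,F)$ consists of $$L_d^e(q_0,q_1)=\int_0^hL(q_{0,1},\dot q_{0,1})\,dt,\quad f_d^{e-}(q_0,q_1)=\int_0^hF(q_{0,1},\dot q_{0,1})\cdot\frac{\partial q_{0,1}}{\partial q_0}\,dt,\quad f_d^{e+}(q_0,q_1)=\int_0^hF(q_{0,1},\dot q_{0,1})\cdot\frac{\partial q_{0,1}}{\partial q_1}\,dt,$$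 and the exact discrete Lagrangian of the duplicated system is $$\mathbf L^e_{\widetilde K_F}(q_0,Q_0,q_1,Q_1)=\int_0^h\mathbf L_{\widetilde K_F}(q,\dot q,Q,\dot Q)\,dt .$$ **Proposition.** For every $(q_0,q_1)\in W$, at the identity $\tilde\epsilon_d(q_0,q_1)$, i.e. $Q_0=q_0$, $Q_1=q_1$: 1. the duplicated solution is $(q(t),Q(t))=(q_{0,1}(t),q_{0,1}(t))$, and $\mathbf L^e_{\widetilde K_F}=0$; 2. $L_d^e$ is differentiable at $(q_0,q_1)$ and $\mathbf L^e_{\widetilde K_F}$ at $\tilde\epsilon_d(q_0,q_1)$, where $$\frac{\partial\mathbf L^e_{\widetilde K_F}}{\partial Q_0}=-\frac{\partial\mathbf L^e_{\widetilde K_F}}{\partial q_0}=D_1L_d^e+f_d^{e-},\qquad \frac{\partial\mathbf L^e_{\widetilde K_F}}{\partial Q_1}=-\frac{\partial\mathbf L^e_{\widetilde K_F}}{\partial q_1}=D_2L_d^e+f_d^{e+};$$ 3. $\widetilde K_F$ generates the exact discrete forces: the function $\widetilde K_d(q_0,Q_0,q_1,Q_1)=\int_0^h\widetilde K_F(\dot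 q(t),\dot Q(t))\,dt$, where $q$ and $Q$ are the solutions of the *forced* system with endpoints $(q_0,q_1)$ and $(Q_0,Q_1)$, is differentiable at $\tilde\epsilon_d(q_0,q_1)$, with $$\frac{\partial\widetilde K_d}{\partial q_0}=-\frac{\partial\widetilde K_d}{\partial Q_0}=f_d^{e-},\qquad \frac{\partial\widetilde K_d}{\partial q_1}=-\frac{\partial\widetilde K_d}{\partial Q_1}=f_d^{e+};$$ 4. the function $\widetilde K_d^e(q_0,Q_0,q_1,Q_1)=\int_0^h\widetilde K_F(\dot q(t),\dot Q(t))\,dt$, where $(q,Q)$ is the solution of the *duplicated* system with these endpoints, is differentiable at $\tilde\epsilon_d(q_0,q_1)$, and its derivative along any variation $\Delta$ of the four endpoints is $$d\widetilde K^e_d\cdot\Delta=\int_0^hF(q_{0,1},\dot q_{0,1})\cdot\bigl(\partial_\Delta q(t)-\partial_\Delta Q(t)\bigr)\,dt .$$ Consequently the discrete Euler–Lagrange equations of $\mathbf L^e_{\widetilde K_F}$ at the identities are two copies, with opposite signs, of the forced discrete Euler–Lagrange equations of Marsden and West: if $(x,y),(y,z)\in W$, the $Q$-component (resp. the $q$-component)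 of $D_1\mathbf L^e_{\widetilde K_F}+D_2\mathbf L^e_{\widetilde K_F}$ at the consecutive points $(x,x),(y,y),(z,z)$ is plus (resp. minus) $$D_1L_d^e(y,z)+D_2L_d^e(x,y)+f_d^{e-}(y,z)+f_d^{e+}(x,y).$$ In particular, for a sequence $q_0,\dots,q_n$ with $(q_k,q_{k+1})\in W$ for all $k<n$, $((q_k,q_k))_k$ solves the discrete Euler–Lagrange equations of $\mathbf L^e_{\widetilde K_F}$ if and only if $(q_k)_k$ solves the forced discrete Euler–Lagrange equations of $(L_d^e,f_d^{e\pm})$. -/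

import Mathlib

open Set Bundle
open scoped Manifold ContDiff Interval

noncomputable section

namespace ForcedLagrangian

section Continuous

variable {E : Type*} [NormedAddCommGroup E] [NormedSpace ℝ E]
  {H : Type*} [TopologicalSpace H] {I : ModelWithCorners ℝ E H}
  {M : Type*} [TopologicalSpace M] [ChartedSpace H M]

/-- An external force: a fibre-preserving map `F : TM → T^*M`, written as the family of
covectors `F(v) ∈ T^*_{π(v)} M`. -/
abbrev Force (I : ModelWithCorners ℝ E H) (M : Type*) [TopologicalSpace M] [ChartedSpace H M] :=
  ∀ v : TangentBundle I M, TangentSpace I v.proj →L[ℝ] ℝ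

/-- The covector `F(v)` read in the model space `E`, to which `TangentSpace I v.proj` unfolds. -/
def Force.toModel (F : Force I M) (v : TangentBundle I M) : E →L[ℝ] ℝ := F v

/-- The zero force. -/
def noForce : Force I M := fun _ => 0

/-- The velocity lift `t ↦ ċ(t) ∈ TM` of a curve on `[0, h]` (one-sided derivatives at the two
ends). -/
def velocity (h : ℝ) (c : ℝ → M) (t : ℝ) : TangentBundle I M :=
  ⟨c t, mfderivWithin 𝓘(ℝ, ℝ) I c (Icc 0 h) t (1 : ℝ)⟩

variable [IsManifold I ∞ M]

/-- The local expression `ℓ(q, v)` of a Lagrangian in the tangent chart induced by the preferred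
chart of `M` at `x`. -/
def localLagrangian (L : TangentBundle I M → ℝ) (x : M) : E × E → ℝ :=
  fun z => L ((extChartAt I.tangent (⟨x, 0⟩ : TangentBundle I M)).symm z)

/-- The coordinates `(q(s), q̇(s))` of the velocity lift of `c` in the tangent chart induced by the
preferred chart of `M` at `x`. -/
def localVelocity (I : ModelWithCorners ℝ E H) [IsManifold I ∞ M]
    (h : ℝ) (c : ℝ → M) (x : M) (s : ℝ) : E × E :=
  extChartAt I.tangent (⟨x, 0⟩ : TangentBundle I M) (velocity (I := I) h c s)

/-- `∂ℓ/∂q`. -/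
def dPos (l : E × E → ℝ) (z : E × E) : E →L[ℝ] ℝ :=
  (fderiv ℝ l z).comp (ContinuousLinearMap.inl ℝ E E)

/-- `∂ℓ/∂v`. -/
def dVel (l : E × E → ℝ) (z : E × E) : E →L[ℝ] ℝ :=
  (fderiv ℝ l z).comp (ContinuousLinearMap.inr ℝ E E)

/-- `c` is a `C²` solution on `[0, h]` of the forced Euler-Lagrange equations
`d/dt (∂L/∂v) - ∂L/∂q = F`. At each time `t` the equation is written in the preferred chart at
`c t`, in which the coordinate expression of a covector at `c t` is the covector itself, because
`TangentSpace I (c t)` is `E` via that chart. -/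
structure IsSolution (L : TangentBundle I M → ℝ) (F : Force I M) (h : ℝ) (c : ℝ → M) :
    Prop where
  contMDiffOn : ContMDiffOn 𝓘(ℝ, ℝ) I 2 c (Icc 0 h)
  eulerLagrange : ∀ t ∈ Icc (0 : ℝ) h,
    HasDerivWithinAt
      (fun s => dVel (localLagrangian L (c t)) (localVelocity I h c (c t) s))
      (dPos (localLagrangian L (c t)) (localVelocity I h c (c t) t)
        + F.toModel (velocity h c t))
      (Icc 0 h) t

/-- `γ` gives, for endpoints `(q₀, q₁)` in the open set `W`, *the* solution `t ↦ γ (q₀, q₁) t` of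
the forced Euler-Lagrange equations on `[0, h]` joining `q₀` to `q₁`: it is the only solution with
these endpoints whose velocities stay in the open set `O ⊆ TM` (`O` may be all of `TM`), and it
depends in a `C²` way on the endpoints and time. -/
structure IsBoundaryValueFamily (L : TangentBundle I M → ℝ) (F : Force I M) (h : ℝ)
    (O : Set (TangentBundle I M)) (W : Set (M × M)) (γ : M × M → ℝ → M) : Prop where
  isOpen_velocities : IsOpen O
  isOpen_endpoints : IsOpen W
  contMDiffOn : ContMDiffOn ((I.prod I).prod 𝓘(ℝ, ℝ)) I 2
    (fun z : (M × M) × ℝ => γ z.1 z.2) (W ×ˢ Icc 0 h)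
  isSolution : ∀ p ∈ W, IsSolution L F h (γ p)
  velocity_mem : ∀ p ∈ W, ∀ t ∈ Icc (0 : ℝ) h, velocity h (γ p) t ∈ O
  start : ∀ p ∈ W, γ p 0 = p.1
  finish : ∀ p ∈ W, γ p h = p.2
  unique : ∀ p ∈ W, ∀ c : ℝ → M, IsSolution L F h c → c 0 = p.1 → c h = p.2 →
    (∀ t ∈ Icc (0 : ℝ) h, velocity h c t ∈ O) → EqOn c (γ p) (Icc 0 h)

/-- Regularity of a Lagrangian: the fibre Hessian `∂²L/∂vⁱ∂vʲ` is nondegenerate everywhere. -/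
def IsRegularLagrangian (L : TangentBundle I M → ℝ) : Prop :=
  ∀ (q : M) (v a : E),
    (∀ b : E, fderiv ℝ (fderiv ℝ (fun w : E => L (⟨q, w⟩ : TangentBundle I M))) v a b = 0) → a = 0

/-- Smoothness of a force, as a map from `TM` to the total space of the cotangent bundle. -/
def IsSmoothForce (F : Force I M) : Prop :=
  ContMDiff I.tangent (I.prod 𝓘(ℝ, E →L[ℝ] ℝ)) ∞
    (fun v : TangentBundle I M =>
      (TotalSpace.mk' (E →L[ℝ] ℝ) v.proj (F v) :
        TotalSpace (E →L[ℝ] ℝ) (fun q : M => TangentSpace I q →L[ℝ] Bundle.Trivial M ℝ q)))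

/-- A retraction `R : TM → M`: smooth, `R_q(0_q) = q` and `T_{0_q} R_q = id`. -/
structure IsRetraction (R : TangentBundle I M → M) : Prop where
  contMDiff : ContMDiff I.tangent I ∞ R
  map_zero : ∀ q : M, R ⟨q, 0⟩ = q
  mfderiv_zero : ∀ (q : M) (w : E),
    (mfderiv 𝓘(ℝ, E) I (fun u : E => R (⟨q, u⟩ : TangentBundle I M)) 0 w : E) = w

/-- `(q, Q) ↦ (q, τ q Q)` is the smooth local inverse of `σ(v_q) = (q, R(v_q))`, from the
neighbourhood `U` of the diagonal to the neighbourhood `Z` of the zero section. -/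
structure IsLocalInverse (R : TangentBundle I M → M) (τ : ∀ q : M, M → TangentSpace I q)
    (Z : Set (TangentBundle I M)) (U : Set (M × M)) : Prop where
  isOpen_source : IsOpen Z
  isOpen_target : IsOpen U
  zero_mem : ∀ q : M, (⟨q, 0⟩ : TangentBundle I M) ∈ Z
  left_inv : ∀ v ∈ Z, (v.proj, R v) ∈ U ∧ τ v.proj (R v) = v.2
  right_inv : ∀ x ∈ U, (⟨x.1, τ x.1 x.2⟩ : TangentBundle I M) ∈ Z ∧ R ⟨x.1, τ x.1 x.2⟩ = x.2
  contMDiffOn : ContMDiffOn (I.prod I) I.tangent ∞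
    (fun x : M × M => (⟨x.1, τ x.1 x.2⟩ : TangentBundle I M)) U

/-- The generalized potential
`K̃_F(v_q, V_Q) = ½ ⟨F(V_Q), τ(Q, q)⟩ - ½ ⟨F(v_q), τ(q, Q)⟩`. -/
def potential (F : Force I M) (τ : ∀ q : M, M → TangentSpace I q) (v V : TangentBundle I M) : ℝ :=
  1 / 2 * F V (τ V.proj v.proj) - 1 / 2 * F v (τ v.proj V.proj)

/-- The duplicated Lagrangian `𝐋_{K̃_F}(v_q, V_Q) = L(V_Q) - L(v_q) - K̃_F(v_q, V_Q)`, as a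
function on `T(M × M) ≅ TM × TM`. -/
def dupLagrangian (L : TangentBundle I M → ℝ) (F : Force I M)
    (τ : ∀ q : M, M → TangentSpace I q) (w : TangentBundle (I.prod I) (M × M)) : ℝ :=
  let p := equivTangentBundleProd I M I M w
  L p.2 - L p.1 - potential F τ p.1 p.2

/-- The identities `v ↦ (v, v)`, `TM → TM × TM ≅ T(M × M)`. -/
def tangentIdentity (v : TangentBundle I M) : TangentBundle (I.prod I) (M × M) :=
  (equivTangentBundleProd I M I M).symm (v, v)

end Continuous

section Discrete

variable {E : Type*} [NormedAddCommGroup E] [NormedSpace ℝ E]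
  {H : Type*} [TopologicalSpace H] {I : ModelWithCorners ℝ E H}
  {M : Type*} [TopologicalSpace M] [ChartedSpace H M]

/-- The discrete identities, `(q₀, q₁) ↦ ((q₀, q₀), (q₁, q₁))`, where an element of
`(M × M) × (M × M)` is the pair of endpoints `((q₀, Q₀), (q₁, Q₁))` of a curve in `M × M`. -/
def discreteIdentity (p : M × M) : (M × M) × (M × M) := ((p.1, p.1), (p.2, p.2))

/-- The exact discrete Lagrangian `(q₀, q₁) ↦ ∫₀ʰ L(q(t), q̇(t)) dt`, where `q(t) = γ (q₀, q₁) t`. -/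
def exactLagrangian (L : TangentBundle I M → ℝ) (h : ℝ) (γ : M × M → ℝ → M) (p : M × M) : ℝ :=
  ∫ t in (0 : ℝ)..h, L (velocity h (γ p) t)

/-- The exact discrete force `f_d^{e-}(q₀, q₁) = ∫₀ʰ F(q(t), q̇(t)) · ∂q(t)/∂q₀ dt ∈ T^*_{q₀} M`. -/
def exactForceMinus (F : Force I M) (h : ℝ) (γ : M × M → ℝ → M) (p : M × M)
    (δ : TangentSpace I p.1) : ℝ :=
  ∫ t in (0 : ℝ)..h, F (velocity h (γ p) t) (mfderiv I I (fun x : M => γ (x, p.2) t) p.1 δ)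

/-- The exact discrete force `f_d^{e+}(q₀, q₁) = ∫₀ʰ F(q(t), q̇(t)) · ∂q(t)/∂q₁ dt ∈ T^*_{q₁} M`. -/
def exactForcePlus (F : Force I M) (h : ℝ) (γ : M × M → ℝ → M) (p : M × M)
    (δ : TangentSpace I p.2) : ℝ :=
  ∫ t in (0 : ℝ)..h, F (velocity h (γ p) t) (mfderiv I I (fun x : M => γ (p.1, x) t) p.2 δ)

/-- The differential of a real function on a manifold, `df(x) · δ`. -/
def differential (I : ModelWithCorners ℝ E H) (f : M → ℝ) (x : M) (δ : TangentSpace I x) : ℝ :=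
  mfderiv I 𝓘(ℝ, ℝ) f x δ

/-- The partial differential `D₁ L_d(q₀, q₁) ∈ T^*_{q₀} M`. -/
def D₁ (I : ModelWithCorners ℝ E H) (Ld : M × M → ℝ) (p : M × M) (δ : TangentSpace I p.1) : ℝ :=
  differential I (fun x : M => Ld (x, p.2)) p.1 δ

/-- The partial differential `D₂ L_d(q₀, q₁) ∈ T^*_{q₁} M`. -/
def D₂ (I : ModelWithCorners ℝ E H) (Ld : M × M → ℝ) (p : M × M) (δ : TangentSpace I p.2) : ℝ :=
  differential I (fun x : M => Ld (p.1, x)) p.2 δ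

/-- The left-hand side of the forced discrete Euler-Lagrange equations at three consecutive points
`x, y, z`:
`D₁ L_d(y, z) + D₂ L_d(x, y) + f_d^-(y, z) + f_d^+(x, y) ∈ T^*_y M`. -/
def forcedDEL (Ld : M × M → ℝ) (fm : ∀ p : M × M, TangentSpace I p.1 → ℝ)
    (fp : ∀ p : M × M, TangentSpace I p.2 → ℝ) (x y z : M) (δ : TangentSpace I y) : ℝ :=
  D₁ I Ld (y, z) δ + D₂ I Ld (x, y) δ + fm (y, z) δ + fp (x, y) δ

/-- The left-hand side `D₁ L_d(y, z) + D₂ L_d(x, y)` of the (unforced) discrete Euler-Lagrange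
equations. -/
def freeDEL (I : ModelWithCorners ℝ E H) (Ld : M × M → ℝ) (x y z : M) (δ : TangentSpace I y) : ℝ :=
  D₁ I Ld (y, z) δ + D₂ I Ld (x, y) δ

/-- The contribution of `K̃_F` along a pair of curves:
`((q₀, Q₀), (q₁, Q₁)) ↦ ∫₀ʰ K̃_F(q̇(t), Q̇(t)) dt`, where `q(t) = γ (q₀, q₁) t` and
`Q(t) = γ (Q₀, Q₁) t`. -/
def pairPotential (F : Force I M) (τ : ∀ q : M, M → TangentSpace I q) (h : ℝ)
    (γ : M × M → ℝ → M) (P : (M × M) × (M × M)) : ℝ :=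
  ∫ t in (0 : ℝ)..h,
    potential F τ (velocity h (γ (P.1.1, P.2.1)) t) (velocity h (γ (P.1.2, P.2.2)) t)

/-- The contribution of `K̃_F` to the exact discrete Lagrangian of the duplicated system:
`((q₀, Q₀), (q₁, Q₁)) ↦ ∫₀ʰ K̃_F(q̇(t), Q̇(t)) dt`, where `(q(t), Q(t)) = Γ ((q₀, Q₀), (q₁, Q₁)) t`. -/
def exactPotential (F : Force I M) (τ : ∀ q : M, M → TangentSpace I q) (h : ℝ)
    (Γ : (M × M) × (M × M) → ℝ → M × M) (P : (M × M) × (M × M)) : ℝ :=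
  ∫ t in (0 : ℝ)..h,
    potential F τ (velocity h (fun s => (Γ P s).1) t) (velocity h (fun s => (Γ P s).2) t)

/-- The variation `∂q(t)·Δ`, read in the model space `E`, of the first component of
`(q(t), Q(t)) = Γ P t` under a variation `Δ` of the endpoints `P`. -/
def variationFst (I : ModelWithCorners ℝ E H) (Γ : (M × M) × (M × M) → ℝ → M × M)
    (P : (M × M) × (M × M)) (t : ℝ)
    (Δ : TangentSpace ((I.prod I).prod (I.prod I)) P) : E :=
  mfderiv ((I.prod I).prod (I.prod I)) I (fun x => (Γ x t).1) P Δ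

/-- The variation `∂Q(t)·Δ`, read in the model space `E`, of the second component of
`(q(t), Q(t)) = Γ P t` under a variation `Δ` of the endpoints `P`. Where `q(t) = Q(t)` it lies in
the same tangent space as the variation of the first component. -/
def variationSnd (I : ModelWithCorners ℝ E H) (Γ : (M × M) × (M × M) → ℝ → M × M)
    (P : (M × M) × (M × M)) (t : ℝ)
    (Δ : TangentSpace ((I.prod I).prod (I.prod I)) P) : E :=
  mfderiv ((I.prod I).prod (I.prod I)) I (fun x => (Γ x t).2) P Δ

end Discrete

end ForcedLagrangian

end

open ForcedLagrangian

/-!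
The generator `K̃` vanishes at the identities `(v, v)`, because `τ(q, q) = 0`, and its derivative
there is `F(v) · (δq - δQ)`, because `τ(q, ·)` is tangent to the identity at `q`. Two facts follow.
The momentum of `𝐋 = L(V) - L(v) - K̃` at `(v, v)` is `(-p, p)` with `p = ∂L/∂v`, and the
Euler–Lagrange equations of `𝐋` along a doubled curve are two copies, with opposite signs, of the
forced equations; so by uniqueness the duplicated solution with doubled endpoints is a doubled
forced solution.

Integrating the equations of motion by parts (the first variation formula) turns the differential of
an exact discrete Lagrangian, corrected by the work of the force on the variation, into the
difference of the momenta `p · δq` at the two ends. Both `𝐋ᵉ` and `(Lᵉ, f⁻, f⁺)` are therefore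
expressed by the same boundary momenta, and the rest is a comparison of signs.
-/

noncomputable section

namespace ForcedLagrangian

open Filter Topology

section Charts

variable {E : Type*} [NormedAddCommGroup E] [NormedSpace ℝ E]
  {H : Type*} [TopologicalSpace H] {I : ModelWithCorners ℝ E H}
  {M : Type*} [TopologicalSpace M] [ChartedSpace H M]

variable (I) in
/-- The differential at `q` of the preferred chart at `x`, read in the model space. -/
def chartDeriv (x q : M) : E →L[ℝ] E :=
  mfderiv I 𝓘(ℝ, E) (extChartAt I x) q

theorem mdifferentiableAt_extChartAt_of_mem_source [IsManifold I 1 M] {x q : M}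
    (hq : q ∈ (extChartAt I x).source) :
    MDifferentiableAt I 𝓘(ℝ, E) (extChartAt I x) q :=
  mdifferentiableAt_extChartAt (extChartAt_source I x ▸ hq)

variable [IsManifold I ∞ M]

theorem chartDeriv_self (x : M) : chartDeriv I x x = ContinuousLinearMap.id ℝ E :=
  mfderiv_extChartAt_self

theorem chartDeriv_surjective {x q : M} (hq : q ∈ (extChartAt I x).source) :
    Function.Surjective (chartDeriv I x q) :=
  (isInvertible_mfderiv_extChartAt hq).surjective

variable (I) in
/-- The tangent chart of `TM` induced by the preferred chart of `M` at `x`. -/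
abbrev tangentChart (x : M) : PartialEquiv (TangentBundle I M) (E × E) :=
  extChartAt I.tangent (⟨x, 0⟩ : TangentBundle I M)

theorem mem_tangentChart_source {x : M} {v : TangentBundle I M} :
    v ∈ (tangentChart I x).source ↔ v.proj ∈ (extChartAt I x).source := by
  simp [TangentBundle.mem_chart_source_iff]

theorem mem_tangentChart_target {x : M} {z : E × E} :
    z ∈ (tangentChart I x).target ↔ z.1 ∈ (extChartAt I x).target := by
  have h_base : z.1 ∈ (extChartAt I x).target → (extChartAt I x).symm z.1 ∈ (chartAt H x).source :=
    fun hz => by simpa only [extChartAt_source] using (extChartAt I x).map_target hz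
  rw [tangentChart, FiberBundle.extChartAt_target]
  simpa using h_base

theorem tangentChart_apply {x : M} {v : TangentBundle I M}
    (hv : v.proj ∈ (extChartAt I x).source) :
    tangentChart I x v = (extChartAt I x v.proj, chartDeriv I x v.proj v.2) := by
  have hv' : v.proj ∈ (chartAt H x).source := by rwa [extChartAt_source] at hv
  have h_fibre : chartDeriv I x v.proj v.2 = (trivializationAt E (TangentSpace I) x v).2 := by
    refine (DFunLike.congr_fun
      (TangentBundle.continuousLinearMapAt_trivializationAt hv') v.2).symm.trans ?_
    rw [Trivialization.continuousLinearMapAt_apply,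
      Trivialization.coe_linearMapAt_of_mem _ (by simpa using hv')]
  rw [h_fibre, tangentChart, FiberBundle.extChartAt]
  simp

theorem tangentChart_self (v : TangentBundle I M) :
    tangentChart I v.proj v = (extChartAt I v.proj v.proj, v.2) := by
  rw [tangentChart_apply (mem_extChartAt_source _), chartDeriv_self]
  rfl

theorem tangentChart_symm_self (v : TangentBundle I M) :
    (tangentChart I v.proj).symm (extChartAt I v.proj v.proj, v.2) = v := by
  have h_left := (tangentChart I v.proj).left_inv
    (mem_tangentChart_source.2 (mem_extChartAt_source v.proj))
  rwa [tangentChart_self] at h_left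

theorem tangentChart_symm_proj {x : M} {z : E × E} (hz : z.1 ∈ (extChartAt I x).target) :
    ((tangentChart I x).symm z).proj = (extChartAt I x).symm z.1 := by
  have hz' := mem_tangentChart_target.2 hz
  have h_src := mem_tangentChart_source.1 ((tangentChart I x).map_target hz')
  have h_fst : z.1 = extChartAt I x ((tangentChart I x).symm z).proj := by
    conv_lhs => rw [← (tangentChart I x).right_inv hz', tangentChart_apply h_src]
  rw [h_fst, (extChartAt I x).left_inv h_src]

theorem tangentChart_symm_apply {x q : M} (hq : q ∈ (extChartAt I x).source) (w : E) :
    (tangentChart I x).symm (extChartAt I x q, chartDeriv I x q w)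
      = (⟨q, w⟩ : TangentBundle I M) := by
  have h_inv := (tangentChart I x).left_inv (x := (⟨q, w⟩ : TangentBundle I M))
    (mem_tangentChart_source.2 hq)
  rwa [tangentChart_apply hq] at h_inv

theorem contMDiffAt_tangentChart {x : M} {v : TangentBundle I M}
    (hv : v.proj ∈ (extChartAt I x).source) :
    ContMDiffAt I.tangent 𝓘(ℝ, E × E) ∞ (tangentChart I x) v := by
  refine contMDiffAt_extChartAt' ?_
  rwa [TangentBundle.mem_chart_source_iff, ← extChartAt_source I]

theorem contMDiffAt_tangentChart_symm [I.Boundaryless] {x : M} {z : E × E}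
    (hz : z.1 ∈ (extChartAt I x).target) :
    ContMDiffAt 𝓘(ℝ, E × E) I.tangent ∞ (tangentChart I x).symm z :=
  (contMDiffOn_extChartAt_symm (I := I.tangent) _).contMDiffAt
    ((isOpen_extChartAt_target _).mem_nhds (mem_tangentChart_target.2 hz))

theorem contMDiff_tangentBundle_mk [I.Boundaryless] (q : M) :
    ContMDiff 𝓘(ℝ, E) I.tangent ∞ (fun u : E => (⟨q, u⟩ : TangentBundle I M)) := by
  intro u
  have hq : q ∈ (extChartAt I q).source := mem_extChartAt_source q
  have h_chart : (fun u : E => (⟨q, u⟩ : TangentBundle I M))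
      = (tangentChart I q).symm ∘ fun u : E => (extChartAt I q q, u) := by
    funext u
    have h_symm := tangentChart_symm_apply hq u
    rw [chartDeriv_self] at h_symm
    exact h_symm.symm
  rw [h_chart]
  exact ContMDiffAt.comp u (contMDiffAt_tangentChart_symm ((extChartAt I q).map_source hq))
    (contDiffAt_const.prodMk contDiffAt_id).contMDiffAt

end Charts

section ProductCharts

variable {E : Type*} [NormedAddCommGroup E] [NormedSpace ℝ E]
  {H : Type*} [TopologicalSpace H] {I : ModelWithCorners ℝ E H}
  {M : Type*} [TopologicalSpace M] [ChartedSpace H M]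

theorem mk_mem_extChartAt_prod_source {x x' q q' : M} (hq : q ∈ (extChartAt I x).source)
    (hq' : q' ∈ (extChartAt I x').source) :
    (q, q') ∈ (extChartAt (I.prod I) (x, x')).source := by
  rw [extChartAt_prod]
  exact ⟨hq, hq'⟩

variable [IsManifold I ∞ M]

theorem chartDeriv_prod {x x' q q' : M} (hq : q ∈ (extChartAt I x).source)
    (hq' : q' ∈ (extChartAt I x').source) :
    chartDeriv (I.prod I) (x, x') (q, q') = (chartDeriv I x q).prodMap (chartDeriv I x' q') := by
  have h_fst := (mdifferentiableAt_extChartAt_of_mem_source hq).hasMFDerivAt.comp (q, q')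
    (hasMFDerivAt_fst (I := I) (I' := I) (q, q'))
  have h_snd := (mdifferentiableAt_extChartAt_of_mem_source hq').hasMFDerivAt.comp (q, q')
    (hasMFDerivAt_snd (I := I) (I' := I) (q, q'))
  have h_prod : HasMFDerivAt (I.prod I) 𝓘(ℝ, E × E)
      (fun p : M × M => (extChartAt I x p.1, extChartAt I x' p.2)) (q, q')
      ((chartDeriv I x q).prodMap (chartDeriv I x' q')) :=
    ⟨h_fst.1.prodMk h_snd.1, h_fst.2.prodMk h_snd.2⟩
  rw [chartDeriv, extChartAt_prod]
  exact h_prod.mfderiv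

theorem tangentChart_prod {x x' : M} {v v' : TangentBundle I M}
    (hv : v.proj ∈ (extChartAt I x).source) (hv' : v'.proj ∈ (extChartAt I x').source) :
    tangentChart (I.prod I) (x, x') ((equivTangentBundleProd I M I M).symm (v, v'))
      = (((tangentChart I x v).1, (tangentChart I x' v').1),
          ((tangentChart I x v).2, (tangentChart I x' v').2)) := by
  rw [tangentChart_apply (I := I.prod I) (mk_mem_extChartAt_prod_source hv hv'),
    tangentChart_apply hv, tangentChart_apply hv']
  refine Prod.ext (by rw [extChartAt_prod]; rfl) ?_
  exact DFunLike.congr_fun (chartDeriv_prod hv hv') (v.2, v'.2)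

theorem tangentChart_prod_symm {x x' : M} {z z' : E × E} (hz : z.1 ∈ (extChartAt I x).target)
    (hz' : z'.1 ∈ (extChartAt I x').target) :
    (tangentChart (I.prod I) (x, x')).symm ((z.1, z'.1), (z.2, z'.2))
      = (equivTangentBundleProd I M I M).symm
        ((tangentChart I x).symm z, (tangentChart I x').symm z') := by
  have hz₂ := mem_tangentChart_target.2 hz
  have hz₂' := mem_tangentChart_target.2 hz'
  have h_src := mem_tangentChart_source.1 ((tangentChart I x).map_target hz₂)
  have h_src' := mem_tangentChart_source.1 ((tangentChart I x').map_target hz₂')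
  have h_chart := tangentChart_prod h_src h_src'
  rw [(tangentChart I x).right_inv hz₂, (tangentChart I x').right_inv hz₂'] at h_chart
  rw [← h_chart]
  exact (tangentChart (I.prod I) (x, x')).left_inv
    (mem_tangentChart_source.2 (mk_mem_extChartAt_prod_source h_src h_src'))

theorem tangentChart_tangentIdentity (v : TangentBundle I M) :
    tangentChart (I.prod I) (v.proj, v.proj) (tangentIdentity v)
      = ((extChartAt I v.proj v.proj, extChartAt I v.proj v.proj), (v.2, v.2)) := by
  have h_source := mem_extChartAt_source (I := I) v.proj
  exact (tangentChart_prod h_source h_source).trans (by rw [tangentChart_self]; rfl)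

end ProductCharts

theorem hasFDerivAt_dPos {E : Type*} [NormedAddCommGroup E] [NormedSpace ℝ E] {l : E × E → ℝ}
    {z : E × E} (hl : DifferentiableAt ℝ l z) :
    HasFDerivAt (fun y => l (y, z.2)) (dPos l z) z.1 :=
  HasFDerivAt.comp (g := l) z.1 hl.hasFDerivAt (hasFDerivAt_prodMk_left z.1 z.2)

section LocalLagrangian

variable {E : Type*} [NormedAddCommGroup E] [NormedSpace ℝ E]
  {H : Type*} [TopologicalSpace H] {I : ModelWithCorners ℝ E H}
  {M : Type*} [TopologicalSpace M] [ChartedSpace H M]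

/-- The fibre derivative (Legendre transform) `v ↦ ∂L/∂v` of a Lagrangian, with its values read
in the dual of the model space. -/
def fibreDeriv (L : TangentBundle I M → ℝ) (v : TangentBundle I M) : E →L[ℝ] ℝ :=
  fderiv ℝ (fun u : E => L (⟨v.proj, u⟩ : TangentBundle I M)) (v.2 : E)

variable [IsManifold I ∞ M]

theorem localLagrangian_tangentChart (L : TangentBundle I M → ℝ) {x : M}
    {v : TangentBundle I M} (hv : v.proj ∈ (extChartAt I x).source) :
    localLagrangian L x (tangentChart I x v) = L v := by
  rw [localLagrangian, (tangentChart I x).left_inv (mem_tangentChart_source.2 hv)]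

variable [I.Boundaryless]

theorem contDiffAt_localLagrangian {L : TangentBundle I M → ℝ} {x : M}
    {v : TangentBundle I M} (hv : v.proj ∈ (extChartAt I x).source)
    (hL : ContMDiffAt I.tangent 𝓘(ℝ, ℝ) 1 L v) :
    ContDiffAt ℝ 1 (localLagrangian L x) (tangentChart I x v) := by
  have hz : (tangentChart I x v).1 ∈ (extChartAt I x).target := by
    rw [tangentChart_apply hv]
    exact (extChartAt I x).map_source hv
  refine (ContMDiffAt.comp (g := L) _ ?_
    ((contMDiffAt_tangentChart_symm hz).of_le (by simp))).contDiffAt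
  rwa [(tangentChart I x).left_inv (mem_tangentChart_source.2 hv)]

theorem hasFDerivAt_localLagrangian {L : TangentBundle I M → ℝ} {x : M}
    {v : TangentBundle I M} (hv : v.proj ∈ (extChartAt I x).source)
    (hL : ContMDiffAt I.tangent 𝓘(ℝ, ℝ) 1 L v) :
    HasFDerivAt (localLagrangian L x) (fderiv ℝ (localLagrangian L x) (tangentChart I x v))
      (tangentChart I x v) :=
  ((contDiffAt_localLagrangian hv hL).differentiableAt one_ne_zero).hasFDerivAt

theorem hasFDerivAt_fibreDeriv {L : TangentBundle I M → ℝ} {q : M} {u : E}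
    (hL : ContMDiffAt I.tangent 𝓘(ℝ, ℝ) 1 L ⟨q, u⟩) :
    HasFDerivAt (fun u' : E => L (⟨q, u'⟩ : TangentBundle I M)) (fibreDeriv L ⟨q, u⟩) u :=
  ((ContMDiffAt.comp u hL
    ((contMDiff_tangentBundle_mk q u).of_le (by simp))).contDiffAt.differentiableAt
      one_ne_zero).hasFDerivAt

theorem dVel_localLagrangian {L : TangentBundle I M → ℝ} {x : M}
    {v : TangentBundle I M} (hv : v.proj ∈ (extChartAt I x).source)
    (hL : ContMDiffAt I.tangent 𝓘(ℝ, ℝ) 1 L v) (w : E) :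
    dVel (localLagrangian L x) (tangentChart I x v) (chartDeriv I x v.proj w)
      = fibreDeriv L v w := by
  obtain ⟨q, (u : E)⟩ := v
  have h_local := hasFDerivAt_localLagrangian hv hL
  rw [tangentChart_apply hv] at h_local ⊢
  have h_comp : HasFDerivAt
      (fun u' : E => localLagrangian L x (extChartAt I x q, chartDeriv I x q u')) _ u :=
    HasFDerivAt.comp (g := localLagrangian L x) u h_local
      ((hasFDerivAt_const (extChartAt I x q) u).prodMk (chartDeriv I x q).hasFDerivAt)
  simp only [localLagrangian, tangentChart_symm_apply hv] at h_comp
  rw [(hasFDerivAt_fibreDeriv hL).unique h_comp]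
  simp [dVel]

end LocalLagrangian

section ParametricIntegral

variable {X Y : Type*} [NormedAddCommGroup X] [NormedSpace ℝ X]
  [NormedAddCommGroup Y] [NormedSpace ℝ Y] {V : Set X} {K : Set ℝ} {e : X}

theorem hasFDerivAt_slice (hV : IsOpen V) {f : X × ℝ → Y} {t : ℝ} (he : e ∈ V)
    (ht : t ∈ K) (hf : DifferentiableWithinAt ℝ f (V ×ˢ K) (e, t)) :
    HasFDerivAt (fun x => f (x, t))
      ((fderivWithin ℝ f (V ×ˢ K) (e, t)).comp (ContinuousLinearMap.inl ℝ X ℝ)) e := by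
  have h_incl : HasFDerivWithinAt (fun x : X => (x, t)) (ContinuousLinearMap.inl ℝ X ℝ) V e :=
    (hasFDerivAt_prodMk_left e t).hasFDerivWithinAt
  have h_maps : MapsTo (fun x : X => (x, t)) V (V ×ˢ K) := fun _ hx => ⟨hx, ht⟩
  exact (hf.hasFDerivWithinAt.comp e h_incl h_maps).hasFDerivAt (hV.mem_nhds he)

theorem hasDerivWithinAt_slice {f : X × ℝ → Y} {t : ℝ} (he : e ∈ V)
    (hf : DifferentiableWithinAt ℝ f (V ×ˢ K) (e, t)) :
    HasDerivWithinAt (fun s => f (e, s)) (fderivWithin ℝ f (V ×ˢ K) (e, t) (0, 1)) K t := by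
  have h_incl : HasFDerivWithinAt (fun s : ℝ => (e, s)) (ContinuousLinearMap.inr ℝ X ℝ) K t :=
    (hasFDerivAt_prodMk_right e t).hasFDerivWithinAt
  have h_comp := hf.hasFDerivWithinAt.comp t h_incl fun _ hs => ⟨he, hs⟩
  simpa [Function.comp_def] using h_comp.hasDerivWithinAt

theorem continuousOn_fderivWithin_slice (hV : IsOpen V) (hK : UniqueDiffOn ℝ K)
    {g : X × ℝ → Y} (he : e ∈ V)
    (hg : ∀ t ∈ K, ContDiffWithinAt ℝ 1 g (V ×ˢ K) (e, t)) :
    ContinuousOn (fun t => fderivWithin ℝ g (V ×ˢ K) (e, t)) K := fun t ht =>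
  ((hg t ht).fderivWithin_right (m := 0) (hV.uniqueDiffOn.prod hK) (by norm_num)
    ⟨he, ht⟩).continuousWithinAt.comp (Continuous.prodMk_right e).continuousWithinAt
      fun _ hs => ⟨he, hs⟩

theorem continuousOn_fderiv_slice (hV : IsOpen V) (hK : UniqueDiffOn ℝ K)
    {g : X × ℝ → Y} (he : e ∈ V)
    (hg : ∀ t ∈ K, ContDiffWithinAt ℝ 1 g (V ×ˢ K) (e, t)) :
    ContinuousOn (fun t => fderiv ℝ (fun x => g (x, t)) e) K :=
  ((continuousOn_fderivWithin_slice hV hK he hg).clm_comp continuousOn_const).congr fun t ht =>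
    (hasFDerivAt_slice hV he ht ((hg t ht).differentiableWithinAt one_ne_zero)).fderiv

theorem exists_eventually_norm_fderivWithin_le (hV : IsOpen V) (hK : UniqueDiffOn ℝ K)
    (hK' : IsCompact K) {g : X × ℝ → Y} (he : e ∈ V)
    (hg : ∀ t ∈ K, ContDiffWithinAt ℝ 1 g (V ×ˢ K) (e, t)) :
    ∃ C, ∀ᶠ x in 𝓝 e, x ∈ V ∧ ∀ t ∈ K,
      ContDiffWithinAt ℝ 1 g (V ×ˢ K) (x, t) ∧ ‖fderivWithin ℝ g (V ×ˢ K) (x, t)‖ ≤ C := by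
  obtain ⟨C, hC⟩ := hK'.exists_bound_of_continuousOn (continuousOn_fderivWithin_slice hV hK he hg)
  have h_near : ∀ t ∈ K, ∀ᶠ z : X × ℝ in 𝓝 (e, t), z ∈ V ×ˢ K →
      ContDiffWithinAt ℝ 1 g (V ×ˢ K) z ∧ ‖fderivWithin ℝ g (V ×ˢ K) z‖ ≤ C + 1 := by
    intro t ht
    have hz : (e, t) ∈ V ×ˢ K := ⟨he, ht⟩
    have h_diff := (hg t ht).eventually (by simp)
    rw [insert_eq_of_mem hz] at h_diff
    have h_norm := ((hg t ht).fderivWithin_right (m := 0) (hV.uniqueDiffOn.prod hK)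
      (by norm_num) hz).continuousWithinAt.norm
    exact eventually_nhdsWithin_iff.1
      (h_diff.and (h_norm.eventually_le_const ((hC t ht).trans_lt (lt_add_one C))))
  have h_unif := hK'.eventually_forall_of_forall_eventually (x₀ := e)
    (P := fun x t => (x, t) ∈ V ×ˢ K → ContDiffWithinAt ℝ 1 g (V ×ˢ K) (x, t) ∧
      ‖fderivWithin ℝ g (V ×ˢ K) (x, t)‖ ≤ C + 1) h_near
  refine ⟨C + 1, ?_⟩
  filter_upwards [h_unif, hV.mem_nhds he] with x hx hxV
  exact ⟨hxV, fun t ht => hx t ht ⟨hxV, ht⟩⟩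

theorem hasFDerivAt_intervalIntegral_slice {a b : ℝ} (hab : a < b) (hV : IsOpen V)
    {g : X × ℝ → Y} (he : e ∈ V)
    (hg : ∀ t ∈ Icc a b, ContDiffWithinAt ℝ 1 g (V ×ˢ Icc a b) (e, t)) :
    HasFDerivAt (fun x => ∫ t in a..b, g (x, t))
      (∫ t in a..b, fderiv ℝ (fun x => g (x, t)) e) e := by
  have hK := uniqueDiffOn_Icc hab
  have h_uIoc : Ι a b ⊆ Icc a b := uIoc_of_le hab.le ▸ Ioc_subset_Icc_self
  obtain ⟨C, hC⟩ := exists_eventually_norm_fderivWithin_le hV hK isCompact_Icc he hg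
  obtain ⟨s, hs, h_unif⟩ := hC.exists_mem
  have h_slice : ∀ x ∈ s, ∀ t ∈ Icc a b, HasFDerivAt (fun y => g (y, t))
      ((fderivWithin ℝ g (V ×ˢ Icc a b) (x, t)).comp (ContinuousLinearMap.inl ℝ X ℝ)) x :=
    fun x hx t ht => hasFDerivAt_slice hV (h_unif x hx).1 ht
      (((h_unif x hx).2 t ht).1.differentiableWithinAt one_ne_zero)
  have h_cont : ∀ x ∈ s, ContinuousOn (fun t => g (x, t)) (Icc a b) := fun x hx t ht =>
    ((h_unif x hx).2 t ht).1.continuousWithinAt.comp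
      (Continuous.prodMk_right x).continuousWithinAt fun _ hr => ⟨(h_unif x hx).1, hr⟩
  refine intervalIntegral.hasFDerivAt_integral_of_dominated_of_fderiv_le
    (bound := fun _ => C) (F' := fun x t => fderiv ℝ (fun y => g (y, t)) x) hs ?_
    ((h_cont e (mem_of_mem_nhds hs)).intervalIntegrable_of_Icc hab.le)
    (((continuousOn_fderiv_slice hV hK he hg).mono h_uIoc).aestronglyMeasurable
      measurableSet_uIoc) ?_ intervalIntegrable_const ?_
  · filter_upwards [hs] with x hx
    exact ((h_cont x hx).mono h_uIoc).aestronglyMeasurable measurableSet_uIoc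
  · refine Eventually.of_forall fun t ht x hx => ?_
    rw [(h_slice x hx t (h_uIoc ht)).fderiv]
    exact ((ContinuousLinearMap.opNorm_comp_le _ _).trans (mul_le_of_le_one_right
      (norm_nonneg _) (ContinuousLinearMap.norm_inl_le_one ..))).trans
        ((h_unif x hx).2 t (h_uIoc ht)).2
  · exact Eventually.of_forall fun t ht x hx =>
      (h_slice x hx t (h_uIoc ht)).differentiableAt.hasFDerivAt

end ParametricIntegral

section CurveFamilies

variable {B : Type*} [NormedAddCommGroup B] [NormedSpace ℝ B]
  {G : Type*} [TopologicalSpace G] {J : ModelWithCorners ℝ B G}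
  {N : Type*} [TopologicalSpace N] [ChartedSpace G N]
  {E : Type*} [NormedAddCommGroup E] [NormedSpace ℝ E]
  {H : Type*} [TopologicalSpace H] {I : ModelWithCorners ℝ E H}
  {M : Type*} [TopologicalSpace M] [ChartedSpace H M]
  {E' : Type*} [NormedAddCommGroup E'] [NormedSpace ℝ E']
  {H' : Type*} [TopologicalSpace H'] {I' : ModelWithCorners ℝ E' H'}
  {M' : Type*} [TopologicalSpace M'] [ChartedSpace H' M']
  {B' : Type*} [NormedAddCommGroup B'] [NormedSpace ℝ B']
  {G' : Type*} [TopologicalSpace G'] {J' : ModelWithCorners ℝ B' G'}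
  {N' : Type*} [TopologicalSpace N'] [ChartedSpace G' N']
  {h : ℝ} {W : Set N} {γ : N → ℝ → M} {p : N} {t : ℝ}

variable (J I) in
/-- A family of curves `γ p` on `[0, h]`, with `p` in the open set `W` of parameters, which depends
in a `C²` way on the parameter and time. -/
structure IsCurveFamily (h : ℝ) (W : Set N) (γ : N → ℝ → M) : Prop where
  isOpen : IsOpen W
  contMDiffOn : ContMDiffOn (J.prod 𝓘(ℝ, ℝ)) I 2 (fun z : N × ℝ => γ z.1 z.2) (W ×ˢ Icc 0 h)

variable (J I) in
/-- The variation field `δ ↦ ∂γ_p(t) · δ` of a family of curves with respect to its parameter, read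
in the model spaces. -/
def variation (γ : N → ℝ → M) (p : N) (t : ℝ) : B →L[ℝ] E :=
  mfderiv J I (fun x => γ x t) p

namespace IsCurveFamily

theorem comp {V : Set N'} {f : N' → N} (hγ : IsCurveFamily J I h W γ) (hV : IsOpen V)
    (hf : ContMDiffOn J' J 2 f V) (hfV : MapsTo f V W) :
    IsCurveFamily J' I h V fun x => γ (f x) where
  isOpen := hV
  contMDiffOn := hγ.contMDiffOn.comp (hf.prodMap contMDiffOn_id) fun _ hz => ⟨hfV hz.1, hz.2⟩

theorem prodMk {γ' : N → ℝ → M'} (hγ : IsCurveFamily J I h W γ)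
    (hγ' : IsCurveFamily J I' h W γ') :
    IsCurveFamily J (I.prod I') h W fun x t => (γ x t, γ' x t) where
  isOpen := hγ.isOpen
  contMDiffOn := hγ.contMDiffOn.prodMk hγ'.contMDiffOn

theorem fst {γ : N → ℝ → M × M'} (hγ : IsCurveFamily J (I.prod I') h W γ) :
    IsCurveFamily J I h W fun x t => (γ x t).1 where
  isOpen := hγ.isOpen
  contMDiffOn := contMDiff_fst.comp_contMDiffOn hγ.contMDiffOn

theorem snd {γ : N → ℝ → M × M'} (hγ : IsCurveFamily J (I.prod I') h W γ) :
    IsCurveFamily J I' h W fun x t => (γ x t).2 where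
  isOpen := hγ.isOpen
  contMDiffOn := contMDiff_snd.comp_contMDiffOn hγ.contMDiffOn

theorem contMDiffAt_slice (hγ : IsCurveFamily J I h W γ) (hp : p ∈ W) (ht : t ∈ Icc 0 h) :
    ContMDiffAt J I 2 (fun x => γ x t) p := by
  have h_slice : ContMDiffOn J I 2 (fun x => γ x t) W :=
    hγ.contMDiffOn.comp (contMDiff_id.prodMk contMDiff_const).contMDiffOn fun _ hx => ⟨hx, ht⟩
  exact h_slice.contMDiffAt (hγ.isOpen.mem_nhds hp)

theorem contMDiffOn_curve (hγ : IsCurveFamily J I h W γ) (hp : p ∈ W) :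
    ContMDiffOn 𝓘(ℝ, ℝ) I 2 (γ p) (Icc 0 h) :=
  hγ.contMDiffOn.comp (contMDiff_const.prodMk contMDiff_id).contMDiffOn fun _ ht => ⟨hp, ht⟩

theorem mdifferentiableWithinAt_curve (hγ : IsCurveFamily J I h W γ) (hp : p ∈ W)
    (ht : t ∈ Icc 0 h) : MDifferentiableWithinAt 𝓘(ℝ, ℝ) I (γ p) (Icc 0 h) t :=
  (hγ.contMDiffOn_curve hp t ht).mdifferentiableWithinAt two_ne_zero

theorem comp_extChartAt_symm [J.Boundaryless] [IsManifold J ∞ N] (hγ : IsCurveFamily J I h W γ)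
    (p : N) :
    IsCurveFamily 𝓘(ℝ, B) I h ((extChartAt J p).target ∩ (extChartAt J p).symm ⁻¹' W)
      fun y => γ ((extChartAt J p).symm y) :=
  hγ.comp ((continuousOn_extChartAt_symm p).isOpen_inter_preimage
      (isOpen_extChartAt_target p) hγ.isOpen)
    ((contMDiffOn_extChartAt_symm p).mono inter_subset_left)
    inter_subset_right

end IsCurveFamily

theorem extChartAt_mem_target_inter_preimage_symm (hp : p ∈ W) :
    extChartAt J p p ∈ (extChartAt J p).target ∩ (extChartAt J p).symm ⁻¹' W :=
  ⟨mem_extChartAt_target p, by rwa [mem_preimage, extChartAt_to_inv]⟩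

theorem hasMFDerivAt_comp_extChartAt_symm_iff [J.Boundaryless] {f : N → M} {f' : B →L[ℝ] E} :
    HasMFDerivAt 𝓘(ℝ, B) I (f ∘ (extChartAt J p).symm) (extChartAt J p p) f'
      ↔ HasMFDerivAt J I f p f' := by
  have h_cont : ContinuousAt (f ∘ (extChartAt J p).symm) (extChartAt J p p)
      ↔ ContinuousAt f p := by
    refine ⟨fun hf => ?_, fun hf => ?_⟩
    · refine (ContinuousAt.comp hf (continuousAt_extChartAt (I := J) p)).congr ?_
      filter_upwards [extChartAt_source_mem_nhds (I := J) p] with x hx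
      simp only [Function.comp_apply, (extChartAt J p).left_inv hx]
    · exact ContinuousAt.comp (by rwa [extChartAt_to_inv]) (continuousAt_extChartAt_symm p)
  refine and_congr h_cont ?_
  simp only [writtenInExtChartAt, extChartAt_model_space_eq_id, extChartAt_to_inv,
    Function.comp_def, J.range_eq_univ, modelWithCornersSelf_coe, range_id, PartialEquiv.refl_coe,
    PartialEquiv.refl_symm, id_eq]
  rfl

theorem mfderiv_comp_extChartAt_symm [J.Boundaryless] (f : N → M) (p : N) :
    mfderiv 𝓘(ℝ, B) I (f ∘ (extChartAt J p).symm) (extChartAt J p p) = mfderiv J I f p := by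
  by_cases hf : MDifferentiableAt J I f p
  · exact (hasMFDerivAt_comp_extChartAt_symm_iff.2 hf.hasMFDerivAt).mfderiv
  · have hf' : ¬ MDifferentiableAt 𝓘(ℝ, B) I (f ∘ (extChartAt J p).symm) (extChartAt J p p) :=
      fun h_local =>
        hf (hasMFDerivAt_comp_extChartAt_symm_iff.1 h_local.hasMFDerivAt).mdifferentiableAt
    rw [mfderiv_zero_of_not_mdifferentiableAt hf, mfderiv_zero_of_not_mdifferentiableAt hf']
    rfl

theorem variation_comp_extChartAt_symm [J.Boundaryless] (γ : N → ℝ → M) (p : N) (t : ℝ) :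
    variation 𝓘(ℝ, B) I (fun y => γ ((extChartAt J p).symm y)) (extChartAt J p p) t
      = variation J I γ p t :=
  mfderiv_comp_extChartAt_symm (fun x => γ x t) p

end CurveFamilies

section LocalFamily

theorem mem_closure_interior_prod_Icc {X : Type*} [TopologicalSpace X] {V : Set X} {e : X}
    {h t : ℝ} (hV : IsOpen V) (hh : 0 < h) (he : e ∈ V) (ht : t ∈ Icc 0 h) :
    (e, t) ∈ closure (interior (V ×ˢ Icc 0 h)) := by
  rw [interior_prod_eq, hV.interior_eq, interior_Icc, closure_prod_eq, closure_Ioo hh.ne]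
  exact ⟨subset_closure he, ht⟩

variable {X : Type*} [NormedAddCommGroup X] [NormedSpace ℝ X]
  {E : Type*} [NormedAddCommGroup E] [NormedSpace ℝ E]
  {H : Type*} [TopologicalSpace H] {I : ModelWithCorners ℝ E H}
  {M : Type*} [TopologicalSpace M] [ChartedSpace H M]
  {h : ℝ} {V : Set X} {γ : X → ℝ → M} {e : X} {t : ℝ} {x : M}

variable (I) in
/-- The coordinate expression of a family of curves in the preferred chart at `x`, as a function of
the parameter and time together. -/
def localFamily (γ : X → ℝ → M) (x : M) (z : X × ℝ) : E :=
  extChartAt I x (γ z.1 z.2)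

theorem uniqueDiffOn_prod_Icc (hV : IsOpen V) (hh : 0 < h) : UniqueDiffOn ℝ (V ×ˢ Icc 0 h) :=
  hV.uniqueDiffOn.prod (uniqueDiffOn_Icc hh)

namespace IsCurveFamily

theorem contMDiffWithinAt_uncurry (hγ : IsCurveFamily 𝓘(ℝ, X) I h V γ) (he : e ∈ V)
    (ht : t ∈ Icc 0 h) :
    ContMDiffWithinAt 𝓘(ℝ, X × ℝ) I 2 (fun z : X × ℝ => γ z.1 z.2) (V ×ˢ Icc 0 h) (e, t) := by
  rw [modelWithCornersSelf_prod, ← chartedSpaceSelf_prod]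
  exact hγ.contMDiffOn (e, t) ⟨he, ht⟩

theorem eventually_mem_source (hγ : IsCurveFamily 𝓘(ℝ, X) I h V γ) (he : e ∈ V)
    (ht : t ∈ Icc 0 h) (hx : γ e t ∈ (extChartAt I x).source) :
    ∀ᶠ z in 𝓝[V ×ˢ Icc 0 h] (e, t),
      z ∈ V ×ˢ Icc 0 h ∧ γ z.1 z.2 ∈ (extChartAt I x).source :=
  eventually_mem_nhdsWithin.and
    ((hγ.contMDiffWithinAt_uncurry he ht).continuousWithinAt.eventually_mem
      ((isOpen_extChartAt_source x).mem_nhds hx))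

variable [IsManifold I ∞ M]

theorem contDiffWithinAt_localFamily (hγ : IsCurveFamily 𝓘(ℝ, X) I h V γ) (he : e ∈ V)
    (ht : t ∈ Icc 0 h) (hx : γ e t ∈ (extChartAt I x).source) :
    ContDiffWithinAt ℝ 2 (localFamily I γ x) (V ×ˢ Icc 0 h) (e, t) := by
  rw [extChartAt_source] at hx
  exact ((contMDiffAt_extChartAt' hx).comp_contMDiffWithinAt (e, t)
    (hγ.contMDiffWithinAt_uncurry he ht)).contDiffWithinAt

theorem differentiableWithinAt_fderivWithin_localFamily (hγ : IsCurveFamily 𝓘(ℝ, X) I h V γ)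
    (hh : 0 < h) (he : e ∈ V) (ht : t ∈ Icc 0 h) (hx : γ e t ∈ (extChartAt I x).source) :
    DifferentiableWithinAt ℝ (fderivWithin ℝ (localFamily I γ x) (V ×ˢ Icc 0 h))
      (V ×ˢ Icc 0 h) (e, t) :=
  ((hγ.contDiffWithinAt_localFamily he ht hx).fderivWithin_right (m := 1)
    (uniqueDiffOn_prod_Icc hγ.isOpen hh) (by norm_num) ⟨he, ht⟩).differentiableWithinAt one_ne_zero

theorem localVelocity_eq (hγ : IsCurveFamily 𝓘(ℝ, X) I h V γ) (hh : 0 < h) (he : e ∈ V)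
    (ht : t ∈ Icc 0 h) (hx : γ e t ∈ (extChartAt I x).source) :
    localVelocity I h (γ e) x t = (localFamily I γ x (e, t),
      fderivWithin ℝ (localFamily I γ x) (V ×ˢ Icc 0 h) (e, t) (0, 1)) := by
  refine (tangentChart_apply (v := velocity (I := I) h (γ e) t) hx).trans (Prod.ext rfl ?_)
  have h_unique := uniqueDiffOn_Icc hh t ht
  have h_chain := mfderiv_comp_mfderivWithin t (mdifferentiableAt_extChartAt_of_mem_source hx)
    (hγ.mdifferentiableWithinAt_curve he ht) h_unique.uniqueMDiffWithinAt
  have h_slice := hasDerivWithinAt_slice he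
    ((hγ.contDiffWithinAt_localFamily he ht hx).differentiableWithinAt two_ne_zero)
  rw [mfderivWithin_eq_fderivWithin] at h_chain
  exact (DFunLike.congr_fun h_chain (1 : ℝ)).symm.trans (h_slice.derivWithin h_unique)

theorem chartDeriv_variation (hγ : IsCurveFamily 𝓘(ℝ, X) I h V γ) (he : e ∈ V)
    (ht : t ∈ Icc 0 h) (hx : γ e t ∈ (extChartAt I x).source) (δ : X) :
    chartDeriv I x (γ e t) (variation 𝓘(ℝ, X) I γ e t δ)
      = fderivWithin ℝ (localFamily I γ x) (V ×ˢ Icc 0 h) (e, t) (δ, 0) := by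
  have h_chain := mfderiv_comp e (mdifferentiableAt_extChartAt_of_mem_source hx)
    ((hγ.contMDiffAt_slice he ht).mdifferentiableAt two_ne_zero)
  have h_slice := hasFDerivAt_slice hγ.isOpen he ht
    ((hγ.contDiffWithinAt_localFamily he ht hx).differentiableWithinAt two_ne_zero)
  rw [mfderiv_eq_fderiv] at h_chain
  exact (DFunLike.congr_fun h_chain δ).symm.trans (DFunLike.congr_fun h_slice.fderiv δ)

theorem contDiffWithinAt_localVelocity (hγ : IsCurveFamily 𝓘(ℝ, X) I h V γ) (hh : 0 < h)
    (he : e ∈ V) (ht : t ∈ Icc 0 h) (hx : γ e t ∈ (extChartAt I x).source) :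
    ContDiffWithinAt ℝ 1 (fun z : X × ℝ => localVelocity I h (γ z.1) x z.2)
      (V ×ˢ Icc 0 h) (e, t) := by
  have h_family := hγ.contDiffWithinAt_localFamily he ht hx
  have h_deriv := (h_family.fderivWithin_right (m := 1) (uniqueDiffOn_prod_Icc hγ.isOpen hh)
    (by norm_num) ⟨he, ht⟩).clm_apply (contDiffWithinAt_const (c := ((0 : X), (1 : ℝ))))
  refine ((h_family.of_le one_le_two).prodMk h_deriv).congr_of_eventuallyEq_of_mem ?_ ⟨he, ht⟩
  filter_upwards [hγ.eventually_mem_source he ht hx] with z hz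
  exact hγ.localVelocity_eq hh hz.1.1 hz.1.2 hz.2

theorem hasFDerivAt_localVelocity (hγ : IsCurveFamily 𝓘(ℝ, X) I h V γ) (hh : 0 < h)
    (he : e ∈ V) (ht : t ∈ Icc 0 h) (hx : γ e t ∈ (extChartAt I x).source) :
    HasFDerivAt (fun y => localVelocity I h (γ y) x t)
      (((fderivWithin ℝ (localFamily I γ x) (V ×ˢ Icc 0 h) (e, t)).prod
        ((fderivWithin ℝ (fderivWithin ℝ (localFamily I γ x) (V ×ˢ Icc 0 h))
          (V ×ˢ Icc 0 h) (e, t)).flip (0, 1))).comp (ContinuousLinearMap.inl ℝ X ℝ)) e := by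
  have h_unique := uniqueDiffOn_prod_Icc hγ.isOpen hh (e, t) ⟨he, ht⟩
  have h_family := (hγ.contDiffWithinAt_localFamily he ht hx).differentiableWithinAt two_ne_zero
  have h_deriv := (hγ.differentiableWithinAt_fderivWithin_localFamily hh he ht
    hx).hasFDerivWithinAt.clm_apply (hasFDerivWithinAt_const ((0 : X), (1 : ℝ)) (e, t) _)
  rw [ContinuousLinearMap.comp_zero, zero_add] at h_deriv
  have h_velocity : HasFDerivWithinAt (fun z : X × ℝ => localVelocity I h (γ z.1) x z.2) _
      (V ×ˢ Icc 0 h) (e, t) :=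
    (h_family.hasFDerivWithinAt.prodMk h_deriv).congr_of_eventuallyEq
      ((hγ.eventually_mem_source he ht hx).mono fun z hz =>
        hγ.localVelocity_eq hh hz.1.1 hz.1.2 hz.2) (hγ.localVelocity_eq hh he ht hx)
  rw [← h_velocity.fderivWithin h_unique]
  exact hasFDerivAt_slice hγ.isOpen he ht h_velocity.differentiableWithinAt

variable [I.Boundaryless] {L : TangentBundle I M → ℝ}

theorem contDiffWithinAt_lagrangian (hγ : IsCurveFamily 𝓘(ℝ, X) I h V γ) (hh : 0 < h)
    (he : e ∈ V) (ht : t ∈ Icc 0 h)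
    (hL : ContMDiffAt I.tangent 𝓘(ℝ, ℝ) 1 L (velocity h (γ e) t)) :
    ContDiffWithinAt ℝ 1 (fun z : X × ℝ => L (velocity h (γ z.1) z.2))
      (V ×ˢ Icc 0 h) (e, t) := by
  have hx : γ e t ∈ (extChartAt I (γ e t)).source := mem_extChartAt_source _
  refine (ContDiffAt.comp_contDiffWithinAt (e, t)
    (contDiffAt_localLagrangian (v := velocity h (γ e) t) hx hL)
    (hγ.contDiffWithinAt_localVelocity hh he ht hx)).congr_of_eventuallyEq_of_mem ?_ ⟨he, ht⟩
  filter_upwards [hγ.eventually_mem_source he ht hx] with z hz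
  exact (localLagrangian_tangentChart L hz.2).symm

theorem fderiv_lagrangian_apply (hγ : IsCurveFamily 𝓘(ℝ, X) I h V γ) (hh : 0 < h)
    (he : e ∈ V) (ht : t ∈ Icc 0 h)
    (hL : ContMDiffAt I.tangent 𝓘(ℝ, ℝ) 1 L (velocity h (γ e) t)) (δ : X) :
    fderiv ℝ (fun y => L (velocity h (γ y) t)) e δ
      = dPos (localLagrangian L (γ e t)) (localVelocity I h (γ e) (γ e t) t)
          (variation 𝓘(ℝ, X) I γ e t δ)
        + dVel (localLagrangian L (γ e t)) (localVelocity I h (γ e) (γ e t) t)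
          (fderivWithin ℝ (fderivWithin ℝ (localFamily I γ (γ e t)) (V ×ˢ Icc 0 h))
            (V ×ˢ Icc 0 h) (e, t) (δ, 0) (0, 1)) := by
  have hx : γ e t ∈ (extChartAt I (γ e t)).source := mem_extChartAt_source _
  have h_variation := hγ.chartDeriv_variation he ht hx δ
  rw [chartDeriv_self, ContinuousLinearMap.id_apply] at h_variation
  have h_chain := HasFDerivAt.comp (g := localLagrangian L (γ e t)) e
    (hasFDerivAt_localLagrangian (v := velocity h (γ e) t) hx hL)
    (hγ.hasFDerivAt_localVelocity hh he ht hx)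
  have h_local : (fun y => L (velocity h (γ y) t))
      =ᶠ[𝓝 e] localLagrangian L (γ e t) ∘ fun y => localVelocity I h (γ y) (γ e t) t := by
    filter_upwards [(hγ.contMDiffAt_slice he ht).continuousAt.eventually_mem
      ((isOpen_extChartAt_source (γ e t)).mem_nhds hx)] with y hy
    exact (localLagrangian_tangentChart (v := velocity h (γ y) t) L hy).symm
  rw [h_local.fderiv_eq, h_chain.fderiv, h_variation]
  simp only [dPos, dVel, ContinuousLinearMap.comp_apply, ContinuousLinearMap.inl_apply,
    ContinuousLinearMap.inr_apply, ContinuousLinearMap.prod_apply, ContinuousLinearMap.flip_apply]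
  rw [← map_add, Prod.mk_add_mk, add_zero, zero_add]
  rfl

theorem fibreDeriv_variation_eventuallyEq (hγ : IsCurveFamily 𝓘(ℝ, X) I h V γ) (he : e ∈ V)
    (ht : t ∈ Icc 0 h) (hx : γ e t ∈ (extChartAt I x).source)
    (hL : ∀ s ∈ Icc 0 h, ContMDiffAt I.tangent 𝓘(ℝ, ℝ) 1 L (velocity h (γ e) s)) (δ : X) :
    (fun s => fibreDeriv L (velocity h (γ e) s) (variation 𝓘(ℝ, X) I γ e s δ))
      =ᶠ[𝓝[Icc 0 h] t] fun s => dVel (localLagrangian L x) (localVelocity I h (γ e) x s)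
        (fderivWithin ℝ (localFamily I γ x) (V ×ˢ Icc 0 h) (e, s) (δ, 0)) := by
  have h_cont := (hγ.contMDiffOn_curve he t ht).continuousWithinAt
  filter_upwards [self_mem_nhdsWithin, h_cont.eventually_mem
    ((isOpen_extChartAt_source x).mem_nhds hx)] with s hs hsx
  rw [← hγ.chartDeriv_variation he hs hsx]
  exact (dVel_localLagrangian (v := velocity h (γ e) s) hsx (hL s hs) _).symm

/-- Integrating by parts in the usual proof of the first variation formula amounts to the symmetry
of the second derivative of the family, which holds up to the boundary of `[0, h]`. -/
theorem hasDerivWithinAt_fibreDeriv_variation (hγ : IsCurveFamily 𝓘(ℝ, X) I h V γ) (hh : 0 < h)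
    (he : e ∈ V) (ht : t ∈ Icc 0 h) {F : Force I M}
    (hL : ∀ s ∈ Icc 0 h, ContMDiffAt I.tangent 𝓘(ℝ, ℝ) 1 L (velocity h (γ e) s))
    (h_sol : IsSolution L F h (γ e)) (δ : X) :
    HasDerivWithinAt
      (fun s => fibreDeriv L (velocity h (γ e) s) (variation 𝓘(ℝ, X) I γ e s δ))
      (fderiv ℝ (fun y => L (velocity h (γ y) t)) e δ
        + F.toModel (velocity h (γ e) t) (variation 𝓘(ℝ, X) I γ e t δ))
      (Icc 0 h) t := by
  have hx : γ e t ∈ (extChartAt I (γ e t)).source := mem_extChartAt_source _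
  have h_variation := hγ.chartDeriv_variation he ht hx δ
  rw [chartDeriv_self, ContinuousLinearMap.id_apply] at h_variation
  have h_symm := ((hγ.contDiffWithinAt_localFamily he ht hx).isSymmSndFDerivWithinAt (by simp)
    (uniqueDiffOn_prod_Icc hγ.isOpen hh) (mem_closure_interior_prod_Icc hγ.isOpen hh he ht)
    ⟨he, ht⟩).eq (δ, 0) (0, 1)
  have h_family := (hasDerivWithinAt_slice he
    (hγ.differentiableWithinAt_fderivWithin_localFamily hh he ht hx)).clm_apply
      (hasDerivWithinAt_const t (Icc 0 h) ((δ, 0) : X × ℝ))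
  rw [map_zero, add_zero, ← h_symm] at h_family
  refine (((h_sol.eulerLagrange t ht).clm_apply h_family).congr_of_eventuallyEq_of_mem
    (hγ.fibreDeriv_variation_eventuallyEq he ht hx hL δ) ht).congr_deriv ?_
  rw [hγ.fderiv_lagrangian_apply hh he ht (hL t ht), ← h_variation, add_apply]
  ring

end IsCurveFamily

end LocalFamily

section Action

variable {B : Type*} [NormedAddCommGroup B] [NormedSpace ℝ B]
  {G : Type*} [TopologicalSpace G] {J : ModelWithCorners ℝ B G}
  {N : Type*} [TopologicalSpace N] [ChartedSpace G N]
  {X : Type*} [NormedAddCommGroup X] [NormedSpace ℝ X]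
  {E : Type*} [NormedAddCommGroup E] [NormedSpace ℝ E]
  {H : Type*} [TopologicalSpace H] {I : ModelWithCorners ℝ E H}
  {M : Type*} [TopologicalSpace M] [ChartedSpace H M]
  {L : TangentBundle I M → ℝ} {F : Force I M} {h : ℝ}
  {W : Set N} {γ : N → ℝ → M} {p : N} {V : Set X} {c : X → ℝ → M} {e : X}

/-- The action `∫₀ʰ L(c(t), ċ(t)) dt` of a curve. -/
def action (L : TangentBundle I M → ℝ) (h : ℝ) (c : ℝ → M) : ℝ :=
  ∫ t in (0 : ℝ)..h, L (velocity h c t)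

theorem fderiv_comp_extChartAt_symm [J.Boundaryless] (f : N → ℝ) (p : N) (δ : B) :
    fderiv ℝ (fun y => f ((extChartAt J p).symm y)) (extChartAt J p p) δ
      = differential J f p δ := by
  rw [← mfderiv_eq_fderiv]
  exact DFunLike.congr_fun (mfderiv_comp_extChartAt_symm f p) δ

theorem IsCurveFamily.variation_eq_mfderivWithin (hγ : IsCurveFamily J I h W γ) (hp : p ∈ W)
    {t : ℝ} (ht : t ∈ Icc 0 h) (δ : B) :
    variation J I γ p t δ = mfderivWithin (J.prod 𝓘(ℝ, ℝ)) I (fun z : N × ℝ => γ z.1 z.2)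
      (W ×ˢ Icc 0 h) (p, t) (δ, (0 : ℝ)) := by
  have h_slice : HasMFDerivAt J (J.prod 𝓘(ℝ, ℝ)) (fun x : N => (x, t)) p _ :=
    (hasMFDerivAt_id p).prodMk (hasMFDerivAt_const t p)
  have h_family := ((hγ.contMDiffOn (p, t) ⟨hp, ht⟩).mdifferentiableWithinAt
    two_ne_zero).hasMFDerivWithinAt
  have h_maps : W ⊆ (fun x : N => (x, t)) ⁻¹' (W ×ˢ Icc 0 h) := fun _ hx => ⟨hx, ht⟩
  have h_chain := HasMFDerivWithinAt.comp p h_family h_slice.hasMFDerivWithinAt h_maps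
  exact DFunLike.congr_fun (h_chain.hasMFDerivAt (hγ.isOpen.mem_nhds hp)).mfderiv δ

variable [IsManifold I ∞ M]

theorem continuousOn_velocity (hh : 0 < h) {c : ℝ → M}
    (hc : ContMDiffOn 𝓘(ℝ, ℝ) I 1 c (Icc 0 h)) :
    ContinuousOn (velocity (I := I) h c) (Icc 0 h) := by
  have h_unit : Continuous fun t : ℝ => (⟨t, 1⟩ : TangentBundle 𝓘(ℝ, ℝ) ℝ) :=
    (tangentBundleModelSpaceHomeomorph 𝓘(ℝ, ℝ)).symm.continuous.comp
      (Continuous.prodMk_left (1 : ℝ))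
  exact (hc.continuousOn_tangentMapWithin le_rfl (uniqueDiffOn_Icc hh).uniqueMDiffOn).comp
    h_unit.continuousOn fun _ ht => ht

namespace IsCurveFamily

theorem continuousOn_variation [IsManifold J ∞ N] (hγ : IsCurveFamily J I h W γ) (hh : 0 < h)
    (hp : p ∈ W) (δ : B) :
    ContinuousOn (fun t => (⟨γ p t, variation J I γ p t δ⟩ : TangentBundle I M)) (Icc 0 h) := by
  have h_dir : Continuous fun t : ℝ => (equivTangentBundleProd J N 𝓘(ℝ, ℝ) ℝ).symm
      ((⟨p, δ⟩ : TangentBundle J N), (⟨t, 0⟩ : TangentBundle 𝓘(ℝ, ℝ) ℝ)) :=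
    (contMDiff_equivTangentBundleProd_symm (I := J) (M := N) (I' := 𝓘(ℝ, ℝ)) (M' := ℝ)
      (n := 0)).continuous.comp
      (continuous_const.prodMk ((tangentBundleModelSpaceHomeomorph 𝓘(ℝ, ℝ)).symm.continuous.comp
        (Continuous.prodMk_left (0 : ℝ))))
  have h_unique := (hγ.isOpen.uniqueMDiffOn (I := J)).prod (uniqueDiffOn_Icc hh).uniqueMDiffOn
  refine ((hγ.contMDiffOn.continuousOn_tangentMapWithin one_le_two h_unique).comp
    h_dir.continuousOn fun t ht => ⟨hp, ht⟩).congr fun t ht => ?_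
  exact congrArg (TotalSpace.mk (γ p t)) (hγ.variation_eq_mfderivWithin hp ht δ)

theorem continuousOn_force_variation [IsManifold J ∞ N] (hγ : IsCurveFamily J I h W γ)
    (hF : IsSmoothForce F) (hh : 0 < h) (hp : p ∈ W) (δ : B) :
    ContinuousOn (fun t => F.toModel (velocity h (γ p) t) (variation J I γ p t δ)) (Icc 0 h) := by
  have h_force := hF.continuous.comp_continuousOn
    (continuousOn_velocity hh ((hγ.contMDiffOn_curve hp).of_le one_le_two))
  exact (Trivial.homeomorphProd M ℝ).continuous.snd.comp_continuousOn
    (h_force.clm_bundle_apply (hγ.continuousOn_variation hh hp δ))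

variable [I.Boundaryless]

theorem hasFDerivAt_action (hc : IsCurveFamily 𝓘(ℝ, X) I h V c) (hh : 0 < h) (he : e ∈ V)
    (hL : ∀ t ∈ Icc 0 h, ContMDiffAt I.tangent 𝓘(ℝ, ℝ) 1 L (velocity h (c e) t)) :
    HasFDerivAt (fun y => action L h (c y))
      (∫ t in (0 : ℝ)..h, fderiv ℝ (fun y => L (velocity h (c y) t)) e) e :=
  hasFDerivAt_intervalIntegral_slice (g := fun z : X × ℝ => L (velocity h (c z.1) z.2)) hh
    hc.isOpen he fun t ht => hc.contDiffWithinAt_lagrangian hh he ht (hL t ht)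

theorem continuousOn_fderiv_lagrangian (hc : IsCurveFamily 𝓘(ℝ, X) I h V c) (hh : 0 < h)
    (he : e ∈ V)
    (hL : ∀ t ∈ Icc 0 h, ContMDiffAt I.tangent 𝓘(ℝ, ℝ) 1 L (velocity h (c e) t)) :
    ContinuousOn (fun t => fderiv ℝ (fun y => L (velocity h (c y) t)) e) (Icc 0 h) :=
  continuousOn_fderiv_slice (g := fun z : X × ℝ => L (velocity h (c z.1) z.2)) hc.isOpen
    (uniqueDiffOn_Icc hh) he fun t ht => hc.contDiffWithinAt_lagrangian hh he ht (hL t ht)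

theorem fderiv_action_apply (hc : IsCurveFamily 𝓘(ℝ, X) I h V c) (hh : 0 < h) (he : e ∈ V)
    (hL : ∀ t ∈ Icc 0 h, ContMDiffAt I.tangent 𝓘(ℝ, ℝ) 1 L (velocity h (c e) t)) (δ : X) :
    fderiv ℝ (fun y => action L h (c y)) e δ
      = ∫ t in (0 : ℝ)..h, fderiv ℝ (fun y => L (velocity h (c y) t)) e δ := by
  rw [(hc.hasFDerivAt_action hh he hL).fderiv]
  exact ContinuousLinearMap.intervalIntegral_apply
    ((hc.continuousOn_fderiv_lagrangian hh he hL).intervalIntegrable_of_Icc hh.le) δ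

theorem fderiv_action_add_integral_force (hc : IsCurveFamily 𝓘(ℝ, X) I h V c)
    (hF : IsSmoothForce F) (hh : 0 < h) (he : e ∈ V)
    (hL : ∀ t ∈ Icc 0 h, ContMDiffAt I.tangent 𝓘(ℝ, ℝ) 1 L (velocity h (c e) t))
    (h_sol : IsSolution L F h (c e)) (δ : X) :
    fderiv ℝ (fun y => action L h (c y)) e δ
        + ∫ t in (0 : ℝ)..h, F.toModel (velocity h (c e) t) (variation 𝓘(ℝ, X) I c e t δ)
      = fibreDeriv L (velocity h (c e) h) (variation 𝓘(ℝ, X) I c e h δ)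
        - fibreDeriv L (velocity h (c e) 0) (variation 𝓘(ℝ, X) I c e 0 δ) := by
  have h_lagrangian := ((hc.continuousOn_fderiv_lagrangian hh he hL).clm_apply
    (continuousOn_const (c := δ))
    ).intervalIntegrable_of_Icc (μ := MeasureTheory.volume) hh.le
  have h_force := (hc.continuousOn_force_variation hF hh he δ).intervalIntegrable_of_Icc
    (μ := MeasureTheory.volume) hh.le
  have h_deriv : ∀ t ∈ Icc 0 h, HasDerivWithinAt
      (fun s => fibreDeriv L (velocity h (c e) s) (variation 𝓘(ℝ, X) I c e s δ)) _ (Icc 0 h) t :=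
    fun t ht => hc.hasDerivWithinAt_fibreDeriv_variation hh he ht hL h_sol δ
  rw [hc.fderiv_action_apply hh he hL, ← intervalIntegral.integral_add h_lagrangian h_force]
  exact intervalIntegral.integral_eq_sub_of_hasDerivAt_of_le hh.le
    (fun t ht => (h_deriv t ht).continuousWithinAt)
    (fun t ht => (h_deriv t (Ioo_subset_Icc_self ht)).hasDerivAt (Icc_mem_nhds ht.1 ht.2))
    (h_lagrangian.add h_force)

theorem fderiv_action_of_dVel_eq_zero (hc : IsCurveFamily 𝓘(ℝ, X) I h V c) (hh : 0 < h)
    (he : e ∈ V) (hL : ∀ t ∈ Icc 0 h, ContMDiffAt I.tangent 𝓘(ℝ, ℝ) 1 L (velocity h (c e) t))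
    (h_dVel : ∀ t ∈ Icc 0 h,
      dVel (localLagrangian L (c e t)) (localVelocity I h (c e) (c e t) t) = 0) (δ : X) :
    fderiv ℝ (fun y => action L h (c y)) e δ
      = ∫ t in (0 : ℝ)..h, dPos (localLagrangian L (c e t))
          (localVelocity I h (c e) (c e t) t) (variation 𝓘(ℝ, X) I c e t δ) := by
  refine (hc.fderiv_action_apply hh he hL δ).trans (intervalIntegral.integral_congr fun t ht => ?_)
  rw [uIcc_of_le hh.le] at ht
  simp only [hc.fderiv_lagrangian_apply hh he ht (hL t ht), h_dVel t ht,
    zero_apply, add_zero]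

variable [J.Boundaryless] [IsManifold J ∞ N]

theorem mdifferentiableAt_action (hγ : IsCurveFamily J I h W γ) (hh : 0 < h) (hp : p ∈ W)
    (hL : ∀ t ∈ Icc 0 h, ContMDiffAt I.tangent 𝓘(ℝ, ℝ) 1 L (velocity h (γ p) t)) :
    MDifferentiableAt J 𝓘(ℝ, ℝ) (fun x => action L h (γ x)) p := by
  have h_local := (hγ.comp_extChartAt_symm p).hasFDerivAt_action hh
    (extChartAt_mem_target_inter_preimage_symm hp) (L := L) (by rwa [extChartAt_to_inv])
  exact (hasMFDerivAt_comp_extChartAt_symm_iff.1 h_local.hasMFDerivAt).mdifferentiableAt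

theorem differential_action_add_integral_force (hγ : IsCurveFamily J I h W γ)
    (hF : IsSmoothForce F) (hh : 0 < h) (hp : p ∈ W)
    (hL : ∀ t ∈ Icc 0 h, ContMDiffAt I.tangent 𝓘(ℝ, ℝ) 1 L (velocity h (γ p) t))
    (h_sol : IsSolution L F h (γ p)) (δ : B) :
    differential J (fun x => action L h (γ x)) p δ
        + ∫ t in (0 : ℝ)..h, F.toModel (velocity h (γ p) t) (variation J I γ p t δ)
      = fibreDeriv L (velocity h (γ p) h) (variation J I γ p h δ)
        - fibreDeriv L (velocity h (γ p) 0) (variation J I γ p 0 δ) := by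
  have h_local := (hγ.comp_extChartAt_symm p).fderiv_action_add_integral_force hF hh
    (extChartAt_mem_target_inter_preimage_symm hp) (L := L)
    (by rwa [extChartAt_to_inv]) (by rwa [extChartAt_to_inv]) δ
  rw [fderiv_comp_extChartAt_symm (fun x => action L h (γ x))] at h_local
  simpa only [variation_comp_extChartAt_symm, extChartAt_to_inv] using h_local

theorem differential_action_of_dVel_eq_zero (hγ : IsCurveFamily J I h W γ) (hh : 0 < h)
    (hp : p ∈ W) (hL : ∀ t ∈ Icc 0 h, ContMDiffAt I.tangent 𝓘(ℝ, ℝ) 1 L (velocity h (γ p) t))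
    (h_dVel : ∀ t ∈ Icc 0 h,
      dVel (localLagrangian L (γ p t)) (localVelocity I h (γ p) (γ p t) t) = 0) (δ : B) :
    differential J (fun x => action L h (γ x)) p δ
      = ∫ t in (0 : ℝ)..h, dPos (localLagrangian L (γ p t))
          (localVelocity I h (γ p) (γ p t) t) (variation J I γ p t δ) := by
  have h_local := (hγ.comp_extChartAt_symm p).fderiv_action_of_dVel_eq_zero hh
    (extChartAt_mem_target_inter_preimage_symm hp) (L := L)
    (by rwa [extChartAt_to_inv]) (by rwa [extChartAt_to_inv]) δ
  rw [fderiv_comp_extChartAt_symm (fun x => action L h (γ x))] at h_local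
  simpa only [variation_comp_extChartAt_symm, extChartAt_to_inv] using h_local

end IsCurveFamily

end Action

theorem hasFDerivAt_of_eq_zero_on_diag {E F : Type*} [NormedAddCommGroup E] [NormedSpace ℝ E]
    [NormedAddCommGroup F] [NormedSpace ℝ F] {f : E × E → F} {f' : E →L[ℝ] F} {x : E}
    (hf : DifferentiableAt ℝ f (x, x)) (h_diag : ∀ y, f (y, y) = 0)
    (hf' : HasFDerivAt (fun y => f (y, x)) f' x) :
    HasFDerivAt f (f'.comp (ContinuousLinearMap.fst ℝ E E - ContinuousLinearMap.snd ℝ E E))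
      (x, x) := by
  have h_fst : HasFDerivAt (fun y => f (y, x)) _ x :=
    HasFDerivAt.comp (g := f) x hf.hasFDerivAt (hasFDerivAt_prodMk_left x x)
  have h_zero : HasFDerivAt (fun y => f (y, y)) _ x :=
    HasFDerivAt.comp (g := f) x hf.hasFDerivAt ((hasFDerivAt_id x).prodMk (hasFDerivAt_id x))
  simp only [h_diag] at h_zero
  refine hf.hasFDerivAt.congr_fderiv (ContinuousLinearMap.ext fun a => ?_)
  have h_split : a = (a.1 - a.2, 0) + (a.2, a.2) := by simp
  have h_diff := DFunLike.congr_fun (hf'.unique h_fst) (a.1 - a.2)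
  have h_same := DFunLike.congr_fun ((hasFDerivAt_const (0 : F) x).unique h_zero) a.2
  conv_lhs => rw [h_split, map_add]
  exact (congrArg₂ (· + ·) h_diff.symm h_same.symm).trans (add_zero _)

section LocalInverse

variable {E : Type*} [NormedAddCommGroup E] [NormedSpace ℝ E]
  {H : Type*} [TopologicalSpace H] {I : ModelWithCorners ℝ E H}
  {M : Type*} [TopologicalSpace M] [ChartedSpace H M] [IsManifold I ∞ M]
  {R : TangentBundle I M → M} {τ : ∀ q : M, M → TangentSpace I q}
  {Z : Set (TangentBundle I M)} {U : Set (M × M)}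

namespace IsLocalInverse

theorem diag_mem (hτ : IsLocalInverse R τ Z U) (hR : IsRetraction R) (q : M) : (q, q) ∈ U := by
  have h_zero := (hτ.left_inv _ (hτ.zero_mem q)).1
  rwa [hR.map_zero] at h_zero

theorem apply_self (hτ : IsLocalInverse R τ Z U) (hR : IsRetraction R) (q : M) : τ q q = 0 := by
  have h_zero := (hτ.left_inv _ (hτ.zero_mem q)).2
  rwa [hR.map_zero] at h_zero

theorem contMDiffAt_lift (hτ : IsLocalInverse R τ Z U) {q r : M} (hqr : (q, r) ∈ U) :
    ContMDiffAt (I.prod I) I.tangent ∞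
      (fun x : M × M => (⟨x.1, τ x.1 x.2⟩ : TangentBundle I M)) (q, r) :=
  hτ.contMDiffOn.contMDiffAt (hτ.isOpen_target.mem_nhds hqr)

theorem contMDiffAt (hτ : IsLocalInverse R τ Z U) {q r : M} (hqr : (q, r) ∈ U) :
    ContMDiffAt (M' := E) I 𝓘(ℝ, E) ∞ (τ q) r := by
  have h_lift : ContMDiffAt I I.tangent ∞ (fun x => (⟨q, τ q x⟩ : TangentBundle I M)) r :=
    (hτ.contMDiffAt_lift hqr).comp r (contMDiffAt_const.prodMk contMDiffAt_id)
  have h_chart : ContMDiffAt I 𝓘(ℝ, E × E) ∞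
      (fun x => tangentChart I q (⟨q, τ q x⟩ : TangentBundle I M)) r :=
    (contMDiffAt_tangentChart (mem_extChartAt_source q)).comp r h_lift
  refine (contDiff_snd.contMDiff.contMDiffAt.comp r h_chart).congr_of_eventuallyEq
    (.of_forall fun x => ?_)
  exact (congrArg Prod.snd (tangentChart_self (⟨q, τ q x⟩ : TangentBundle I M))).symm

theorem retraction_comp_eventuallyEq (hτ : IsLocalInverse R τ Z U) (hR : IsRetraction R) (q : M) :
    (fun u : E => R (⟨q, u⟩ : TangentBundle I M)) ∘ τ q =ᶠ[𝓝 q] id := by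
  filter_upwards [(Continuous.prodMk_right q).continuousAt.eventually_mem
    (hτ.isOpen_target.mem_nhds (hτ.diag_mem hR q))] with x hx
  exact (hτ.right_inv _ hx).2

variable [I.Boundaryless]

theorem hasMFDerivAt_self (hτ : IsLocalInverse R τ Z U) (hR : IsRetraction R) (q : M) :
    HasMFDerivAt (M' := E) I 𝓘(ℝ, E) (τ q) q (ContinuousLinearMap.id ℝ E) := by
  obtain ⟨τ', h_inverse⟩ : ∃ τ' : E →L[ℝ] E, HasMFDerivAt (M' := E) I 𝓘(ℝ, E) (τ q) q τ' :=
    ⟨_, ((hτ.contMDiffAt (hτ.diag_mem hR q)).mdifferentiableAt (by simp)).hasMFDerivAt⟩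
  have h_retraction : HasMFDerivAt 𝓘(ℝ, E) I (fun u : E => R (⟨q, u⟩ : TangentBundle I M))
      (τ q q) (mfderiv 𝓘(ℝ, E) I (fun u : E => R (⟨q, u⟩ : TangentBundle I M)) (τ q q)) :=
    ((hR.contMDiff.comp (contMDiff_tangentBundle_mk q)).mdifferentiable
      (by simp) _).hasMFDerivAt
  have h_comp := (h_retraction.comp q h_inverse).congr_of_eventuallyEq
    (hτ.retraction_comp_eventuallyEq hR q).symm
  suffices τ' = ContinuousLinearMap.id ℝ E from this ▸ h_inverse
  refine ContinuousLinearMap.ext fun w => ?_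
  have h_apply := DFunLike.congr_fun (hasMFDerivAt_unique h_comp (hasMFDerivAt_id q)) w
  rw [hτ.apply_self hR] at h_apply
  exact (hR.mfderiv_zero q _).symm.trans h_apply

end IsLocalInverse

end LocalInverse

section Potential

variable {E : Type*} [NormedAddCommGroup E] [NormedSpace ℝ E]
  {H : Type*} [TopologicalSpace H] {I : ModelWithCorners ℝ E H}
  {M : Type*} [TopologicalSpace M] [ChartedSpace H M]

/-- The pairing `⟨F(V_Q), τ(Q, q)⟩`, as a function of `(v_q, V_Q)`. -/
def forcePairing (F : Force I M) (τ : ∀ q : M, M → TangentSpace I q)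
    (p : TangentBundle I M × TangentBundle I M) : ℝ :=
  F p.2 (τ p.2.proj p.1.proj)

/-- The potential `K̃_F` as a function on `T(M × M) ≅ TM × TM`. -/
def tangentPotential (F : Force I M) (τ : ∀ q : M, M → TangentSpace I q)
    (w : TangentBundle (I.prod I) (M × M)) : ℝ :=
  potential F τ (equivTangentBundleProd I M I M w).1 (equivTangentBundleProd I M I M w).2

variable [IsManifold I ∞ M] {F : Force I M} {R : TangentBundle I M → M}
  {τ : ∀ q : M, M → TangentSpace I q} {Z : Set (TangentBundle I M)} {U : Set (M × M)}

theorem contMDiffAt_forcePairing (hF : IsSmoothForce F) (hτ : IsLocalInverse R τ Z U)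
    {p : TangentBundle I M × TangentBundle I M} (hp : (p.2.proj, p.1.proj) ∈ U) :
    ContMDiffAt (I.tangent.prod I.tangent) 𝓘(ℝ, ℝ) ∞ (forcePairing F τ) p := by
  have h_proj (v : TangentBundle I M) : ContMDiffAt I.tangent I ∞ (fun v => v.proj) v :=
    contMDiffAt_proj (TangentSpace I)
  have h_vector : ContMDiffAt (I.tangent.prod I.tangent) (I.prod 𝓘(ℝ, E)) ∞
      (fun p : TangentBundle I M × TangentBundle I M =>
        TotalSpace.mk' E p.2.proj (τ p.2.proj p.1.proj)) p :=
    ContMDiffAt.comp p (hτ.contMDiffAt_lift hp)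
      (((h_proj _).comp p contMDiffAt_snd).prodMk ((h_proj _).comp p contMDiffAt_fst))
  have h_covector : ContMDiffAt (I.tangent.prod I.tangent) (I.prod 𝓘(ℝ, E →L[ℝ] ℝ)) ∞
      (fun p : TangentBundle I M × TangentBundle I M =>
        (TotalSpace.mk' (E →L[ℝ] ℝ) p.2.proj (F p.2) :
          TotalSpace (E →L[ℝ] ℝ) (fun q : M => TangentSpace I q →L[ℝ] Trivial M ℝ q))) p :=
    ContMDiffAt.comp p (hF p.2) contMDiffAt_snd
  exact (contMDiffAt_totalSpace.1
    (h_covector.clm_bundle_apply (E₂ := Trivial M ℝ) (F₂ := ℝ) h_vector)).2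

theorem contMDiffAt_tangentPotential (hF : IsSmoothForce F) (hτ : IsLocalInverse R τ Z U)
    {w : TangentBundle (I.prod I) (M × M)} (hw : (w.proj.1, w.proj.2) ∈ U)
    (hw' : (w.proj.2, w.proj.1) ∈ U) :
    ContMDiffAt (I.prod I).tangent 𝓘(ℝ, ℝ) ∞ (tangentPotential F τ) w := by
  have h_equiv : ContMDiffAt (I.prod I).tangent (I.tangent.prod I.tangent) ∞
      (equivTangentBundleProd I M I M) w := contMDiff_equivTangentBundleProd w
  have h_pair := (contMDiffAt_forcePairing hF hτ
    (p := equivTangentBundleProd I M I M w) hw').comp w h_equiv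
  have h_pair' := (contMDiffAt_forcePairing hF hτ
    (p := (equivTangentBundleProd I M I M w).swap) hw).comp w
      ((contMDiffAt_snd.comp w h_equiv).prodMk (contMDiffAt_fst.comp w h_equiv))
  have h_comb : ContDiff ℝ ∞ fun r : ℝ × ℝ => 1 / 2 * r.1 - 1 / 2 * r.2 := by fun_prop
  exact h_comb.contMDiff.contMDiffAt.comp w (h_pair.prodMk_space h_pair')

theorem tangentPotential_mk_self (hR : IsRetraction R) (hτ : IsLocalInverse R τ Z U) (q : M)
    (u : E × E) :
    tangentPotential F τ (⟨(q, q), u⟩ : TangentBundle (I.prod I) (M × M)) = 0 := by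
  change 1 / 2 * F ⟨q, u.2⟩ (τ q q) - 1 / 2 * F ⟨q, u.1⟩ (τ q q) = 0
  simp only [hτ.apply_self hR, map_zero, mul_zero, sub_zero]

theorem fibreDeriv_tangentPotential (hR : IsRetraction R) (hτ : IsLocalInverse R τ Z U)
    (v : TangentBundle I M) :
    fibreDeriv (tangentPotential F τ) (tangentIdentity v) = 0 := by
  have h_zero : (fun u : E × E => tangentPotential F τ
      (⟨(v.proj, v.proj), u⟩ : TangentBundle (I.prod I) (M × M))) = fun _ => 0 :=
    funext fun u => tangentPotential_mk_self hR hτ v.proj u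
  exact (congrArg (fun f => fderiv ℝ f _) h_zero).trans (fderiv_const_apply 0)

variable [I.Boundaryless]

theorem differentiableAt_forcePairing_comp_tangentChart_symm (hF : IsSmoothForce F)
    (hR : IsRetraction R) (hτ : IsLocalInverse R τ Z U) (v : TangentBundle I M) :
    DifferentiableAt ℝ (fun y : E × E => forcePairing F τ
        ((tangentChart I v.proj).symm (y.1, v.2), (tangentChart I v.proj).symm (y.2, v.2)))
      (extChartAt I v.proj v.proj, extChartAt I v.proj v.proj) := by
  have h_symm : ContMDiffAt 𝓘(ℝ, E) I.tangent ∞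
      (fun y : E => (tangentChart I v.proj).symm (y, v.2)) (extChartAt I v.proj v.proj) :=
    ContMDiffAt.comp _ (contMDiffAt_tangentChart_symm (mem_extChartAt_target v.proj))
      (contDiffAt_id.prodMk contDiffAt_const).contMDiffAt
  have h_pair : ContMDiffAt 𝓘(ℝ, E × E) (I.tangent.prod I.tangent) ∞
      (fun y : E × E => ((tangentChart I v.proj).symm (y.1, v.2),
        (tangentChart I v.proj).symm (y.2, v.2)))
      (extChartAt I v.proj v.proj, extChartAt I v.proj v.proj) :=
    (ContMDiffAt.comp (I' := 𝓘(ℝ, E)) (f := Prod.fst) (_, _) h_symm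
        contDiffAt_fst.contMDiffAt).prodMk
      (ContMDiffAt.comp (I' := 𝓘(ℝ, E)) (f := Prod.snd) (_, _) h_symm
        contDiffAt_snd.contMDiffAt)
  have h_pairing := contMDiffAt_forcePairing (p := (v, v)) hF hτ (hτ.diag_mem hR v.proj)
  rw [← tangentChart_symm_self v] at h_pairing
  exact (ContMDiffAt.comp (_, _) h_pairing h_pair).contDiffAt.differentiableAt (by simp)

theorem hasFDerivAt_forcePairing_comp_tangentChart_symm (hF : IsSmoothForce F)
    (hR : IsRetraction R) (hτ : IsLocalInverse R τ Z U) (v : TangentBundle I M) :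
    HasFDerivAt (fun y : E × E => forcePairing F τ
        ((tangentChart I v.proj).symm (y.1, v.2), (tangentChart I v.proj).symm (y.2, v.2)))
      ((F.toModel v).comp (ContinuousLinearMap.fst ℝ E E - ContinuousLinearMap.snd ℝ E E))
      (extChartAt I v.proj v.proj, extChartAt I v.proj v.proj) := by
  refine hasFDerivAt_of_eq_zero_on_diag
    (differentiableAt_forcePairing_comp_tangentChart_symm hF hR hτ v)
    (fun y => by simp only [forcePairing, hτ.apply_self hR, map_zero]) ?_
  have h_inverse := (hasMFDerivAt_comp_extChartAt_symm_iff.2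
    (hτ.hasMFDerivAt_self hR v.proj)).hasFDerivAt
  have h_pair : HasFDerivAt (fun y : E => F.toModel v (τ v.proj ((extChartAt I v.proj).symm y)))
      (F.toModel v) (extChartAt I v.proj v.proj) :=
    (F.toModel v).hasFDerivAt.comp _ h_inverse
  refine h_pair.congr_of_eventuallyEq ?_
  filter_upwards [extChartAt_target_mem_nhds (I := I) v.proj] with y hy
  rw [tangentChart_symm_self, ← tangentChart_symm_proj (z := (y, v.2)) hy]
  rfl

theorem hasFDerivAt_localLagrangian_tangentPotential (hF : IsSmoothForce F)
    (hR : IsRetraction R) (hτ : IsLocalInverse R τ Z U) (v : TangentBundle I M) :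
    HasFDerivAt (fun y : E × E => localLagrangian (I := I.prod I) (tangentPotential F τ)
        (v.proj, v.proj) (y, (v.2, v.2)))
      ((F.toModel v).comp (ContinuousLinearMap.fst ℝ E E - ContinuousLinearMap.snd ℝ E E))
      (extChartAt I v.proj v.proj, extChartAt I v.proj v.proj) := by
  have h_pairing := hasFDerivAt_forcePairing_comp_tangentChart_symm hF hR hτ v
  have h_swap := HasFDerivAt.comp (f := Prod.swap) (_, _) h_pairing
    (hasFDerivAt_snd.prodMk hasFDerivAt_fst)
  refine (((h_pairing.const_mul (1 / 2)).sub (h_swap.const_mul (1 / 2))).congr_of_eventuallyEq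
    ?_).congr_fderiv (ContinuousLinearMap.ext fun a => ?_)
  · have h_target := extChartAt_target_mem_nhds (I := I) v.proj
    filter_upwards [prod_mem_nhds h_target h_target] with y hy
    exact congrArg (tangentPotential F τ)
      (tangentChart_prod_symm (z := (y.1, v.2)) (z' := (y.2, v.2)) hy.1 hy.2)
  · simp only [ContinuousLinearMap.comp_sub, ContinuousLinearMap.sub_comp, sub_apply, smul_apply,
      ContinuousLinearMap.comp_apply, ContinuousLinearMap.coe_fst', ContinuousLinearMap.coe_snd',
      ContinuousLinearMap.prod_apply, smul_eq_mul]
    ring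

theorem dPos_tangentPotential (hF : IsSmoothForce F)
    (hR : IsRetraction R) (hτ : IsLocalInverse R τ Z U) (v : TangentBundle I M) :
    dPos (localLagrangian (I := I.prod I) (tangentPotential F τ) (v.proj, v.proj))
        (tangentChart (I.prod I) (v.proj, v.proj) (tangentIdentity v))
      = (F.toModel v).comp
          (ContinuousLinearMap.fst ℝ E E - ContinuousLinearMap.snd ℝ E E) := by
  have h_local := hasFDerivAt_localLagrangian (x := (v.proj, v.proj)) (v := tangentIdentity v)
    (mem_extChartAt_source (I := I.prod I) (v.proj, v.proj))
    ((contMDiffAt_tangentPotential hF hτ (hτ.diag_mem hR _) (hτ.diag_mem hR _)).of_le (by simp))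
  have h_slice := hasFDerivAt_dPos h_local.differentiableAt
  rw [tangentChart_tangentIdentity] at h_slice ⊢
  exact h_slice.unique (hasFDerivAt_localLagrangian_tangentPotential hF hR hτ v)

theorem dVel_tangentPotential (hF : IsSmoothForce F)
    (hR : IsRetraction R) (hτ : IsLocalInverse R τ Z U) (v : TangentBundle I M) :
    dVel (localLagrangian (I := I.prod I) (tangentPotential F τ) (v.proj, v.proj))
        (tangentChart (I.prod I) (v.proj, v.proj) (tangentIdentity v)) = 0 := by
  refine ContinuousLinearMap.ext fun w => ?_
  have h_local := dVel_localLagrangian (x := (v.proj, v.proj)) (v := tangentIdentity v)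
    (mem_extChartAt_source (I := I.prod I) (v.proj, v.proj))
    ((contMDiffAt_tangentPotential (F := F) hF hτ (hτ.diag_mem hR _)
      (hτ.diag_mem hR _)).of_le (by simp)) w
  rw [fibreDeriv_tangentPotential hR hτ] at h_local
  exact (congrArg _ (DFunLike.congr_fun (chartDeriv_self (I := I.prod I) (v.proj, v.proj)) w).symm
    ).trans h_local

end Potential

section Duplication

variable {E : Type*} [NormedAddCommGroup E] [NormedSpace ℝ E]
  {H : Type*} [TopologicalSpace H] {I : ModelWithCorners ℝ E H}
  {M : Type*} [TopologicalSpace M] [ChartedSpace H M]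

theorem velocity_prodMk {h : ℝ} (hh : 0 < h) {c c' : ℝ → M} {t : ℝ} (ht : t ∈ Icc 0 h)
    (hc : MDifferentiableWithinAt 𝓘(ℝ, ℝ) I c (Icc 0 h) t)
    (hc' : MDifferentiableWithinAt 𝓘(ℝ, ℝ) I c' (Icc 0 h) t) :
    velocity (I := I.prod I) h (fun s => (c s, c' s)) t
      = (equivTangentBundleProd I M I M).symm (velocity h c t, velocity h c' t) := by
  have h_deriv := (hc.hasMFDerivWithinAt.prodMk hc'.hasMFDerivWithinAt).mfderivWithin
    (uniqueDiffOn_Icc hh t ht).uniqueMDiffWithinAt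
  rw [velocity, h_deriv]
  rfl

theorem velocity_congr {h : ℝ} {c c' : ℝ → M} (hcc' : EqOn c c' (Icc 0 h)) {t : ℝ}
    (ht : t ∈ Icc 0 h) : velocity (I := I) h c t = velocity h c' t := by
  have h_deriv : mfderivWithin 𝓘(ℝ, ℝ) I c (Icc 0 h) t = mfderivWithin 𝓘(ℝ, ℝ) I c' (Icc 0 h) t :=
    mfderivWithin_congr hcc' (hcc' ht)
  exact TotalSpace.ext (hcc' ht) (heq_of_eq (DFunLike.congr_fun h_deriv (1 : ℝ)))

theorem velocity_eq_tangentIdentity {h : ℝ} (hh : 0 < h) {c : ℝ → M} {c₂ : ℝ → M × M}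
    (hc : ContMDiffOn 𝓘(ℝ, ℝ) I 2 c (Icc 0 h)) (hc₂ : EqOn c₂ (fun t => (c t, c t)) (Icc 0 h))
    {t : ℝ} (ht : t ∈ Icc 0 h) :
    velocity (I := I.prod I) h c₂ t = tangentIdentity (velocity h c t) :=
  have h_diff := (hc t ht).mdifferentiableWithinAt two_ne_zero
  (velocity_congr hc₂ ht).trans (velocity_prodMk hh ht h_diff h_diff)

variable [IsManifold I ∞ M] {L : TangentBundle I M → ℝ} {F : Force I M}
  {R : TangentBundle I M → M} {τ : ∀ q : M, M → TangentSpace I q}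
  {Z : Set (TangentBundle I M)} {U : Set (M × M)}

theorem contMDiffAt_dupLagrangian (hL : ContMDiff I.tangent 𝓘(ℝ, ℝ) 1 L)
    (hF : IsSmoothForce F) (hτ : IsLocalInverse R τ Z U)
    {w : TangentBundle (I.prod I) (M × M)} (hw : (w.proj.1, w.proj.2) ∈ U)
    (hw' : (w.proj.2, w.proj.1) ∈ U) :
    ContMDiffAt (I.prod I).tangent 𝓘(ℝ, ℝ) 1 (dupLagrangian L F τ) w := by
  have h_equiv : ContMDiffAt (I.prod I).tangent (I.tangent.prod I.tangent) 1
      (equivTangentBundleProd I M I M) w := contMDiff_equivTangentBundleProd w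
  have h_fst := ContMDiffAt.comp w (hL _) (contMDiffAt_fst.comp w h_equiv)
  have h_snd := ContMDiffAt.comp w (hL _) (contMDiffAt_snd.comp w h_equiv)
  exact (h_snd.sub h_fst).sub ((contMDiffAt_tangentPotential hF hτ hw hw').of_le (by simp))

theorem dupLagrangian_tangentIdentity (hR : IsRetraction R) (hτ : IsLocalInverse R τ Z U)
    (v : TangentBundle I M) : dupLagrangian L F τ (tangentIdentity v) = 0 := by
  have h_zero := tangentPotential_mk_self (F := F) hR hτ v.proj (v.2, v.2)
  change L v - L v - tangentPotential F τ _ = 0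
  rw [sub_self, zero_sub, neg_eq_zero]
  exact h_zero

variable [I.Boundaryless]

theorem fibreDeriv_dupLagrangian (hL : ContMDiff I.tangent 𝓘(ℝ, ℝ) 1 L)
    (hR : IsRetraction R) (hτ : IsLocalInverse R τ Z U) (v : TangentBundle I M) :
    fibreDeriv (dupLagrangian L F τ) (tangentIdentity v)
      = (fibreDeriv L v).comp (ContinuousLinearMap.snd ℝ E E - ContinuousLinearMap.fst ℝ E E) := by
  obtain ⟨q, (u : E)⟩ := v
  have h_fibre : (fun u : E × E =>
      dupLagrangian L F τ (⟨(q, q), u⟩ : TangentBundle (I.prod I) (M × M)))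
        = fun u => L ⟨q, u.2⟩ - L ⟨q, u.1⟩ := by
    funext u
    exact (congrArg _ (tangentPotential_mk_self hR hτ q u)).trans (sub_zero _)
  have h_lagrangian := hasFDerivAt_fibreDeriv (hL (⟨q, u⟩ : TangentBundle I M))
  have h_diff : HasFDerivAt (fun u : E × E => L ⟨q, u.2⟩ - L ⟨q, u.1⟩) _ (u, u) :=
    (HasFDerivAt.comp (g := fun u' : E => L ⟨q, u'⟩) (u, u) h_lagrangian hasFDerivAt_snd).sub
      (HasFDerivAt.comp (g := fun u' : E => L ⟨q, u'⟩) (u, u) h_lagrangian hasFDerivAt_fst)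
  rw [ContinuousLinearMap.comp_sub, ← h_diff.fderiv, ← h_fibre]
  rfl

theorem dVel_dupLagrangian (hL : ContMDiff I.tangent 𝓘(ℝ, ℝ) 1 L) (hF : IsSmoothForce F)
    (hR : IsRetraction R) (hτ : IsLocalInverse R τ Z U) {x : M} {v : TangentBundle I M}
    (hv : v.proj ∈ (extChartAt I x).source) :
    dVel (localLagrangian (I := I.prod I) (dupLagrangian L F τ) (x, x))
        (tangentChart (I.prod I) (x, x) (tangentIdentity v))
      = (dVel (localLagrangian L x) (tangentChart I x v)).comp
          (ContinuousLinearMap.snd ℝ E E - ContinuousLinearMap.fst ℝ E E) := by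
  have h_surj : Function.Surjective (chartDeriv (I.prod I) (x, x) (v.proj, v.proj)) :=
    chartDeriv_surjective (mk_mem_extChartAt_prod_source hv hv)
  refine ContinuousLinearMap.ext (h_surj.forall.2 fun w => ?_)
  have h_local := dVel_localLagrangian (I := I.prod I) (x := (x, x)) (v := tangentIdentity v)
    (mk_mem_extChartAt_prod_source hv hv)
    (contMDiffAt_dupLagrangian hL hF hτ (hτ.diag_mem hR _) (hτ.diag_mem hR _)) w
  refine h_local.trans ?_
  rw [fibreDeriv_dupLagrangian hL hR hτ, chartDeriv_prod hv hv]
  simp only [ContinuousLinearMap.comp_apply, sub_apply, ContinuousLinearMap.coe_snd',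
    ContinuousLinearMap.coe_fst', ContinuousLinearMap.coe_prodMap', Prod.map_snd, Prod.map_fst,
    map_sub, dVel_localLagrangian hv (hL v)]

theorem dPos_dupLagrangian (hL : ContMDiff I.tangent 𝓘(ℝ, ℝ) 1 L) (hF : IsSmoothForce F)
    (hR : IsRetraction R) (hτ : IsLocalInverse R τ Z U) (v : TangentBundle I M) :
    dPos (localLagrangian (I := I.prod I) (dupLagrangian L F τ) (v.proj, v.proj))
        (tangentChart (I.prod I) (v.proj, v.proj) (tangentIdentity v))
      = (dPos (localLagrangian L v.proj) (tangentChart I v.proj v) + F.toModel v).comp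
          (ContinuousLinearMap.snd ℝ E E - ContinuousLinearMap.fst ℝ E E) := by
  have h_dup := hasFDerivAt_localLagrangian (x := (v.proj, v.proj)) (v := tangentIdentity v)
    (mem_extChartAt_source (I := I.prod I) (v.proj, v.proj))
    (contMDiffAt_dupLagrangian hL hF hτ (hτ.diag_mem hR _) (hτ.diag_mem hR _))
  have h_dPos := hasFDerivAt_dPos h_dup.differentiableAt
  have h_lagrangian := hasFDerivAt_dPos
    (hasFDerivAt_localLagrangian (mem_extChartAt_source v.proj) (hL v)).differentiableAt
  rw [tangentChart_tangentIdentity] at h_dPos ⊢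
  rw [tangentChart_self] at h_lagrangian ⊢
  have h_split := ((HasFDerivAt.comp (f := Prod.snd) (_, _) h_lagrangian hasFDerivAt_snd).sub
    (HasFDerivAt.comp (f := Prod.fst) (_, _) h_lagrangian hasFDerivAt_fst)).sub
    (hasFDerivAt_localLagrangian_tangentPotential hF hR hτ v)
  refine (h_dPos.unique (h_split.congr_of_eventuallyEq ?_)).trans ?_
  · have h_target := extChartAt_target_mem_nhds (I := I) v.proj
    filter_upwards [prod_mem_nhds h_target h_target] with y hy
    exact congrArg₂ (· - ·) (congrArg (fun w => L (equivTangentBundleProd I M I M w).2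
      - L (equivTangentBundleProd I M I M w).1)
      (tangentChart_prod_symm (z := (y.1, v.2)) (z' := (y.2, v.2)) hy.1 hy.2)) rfl
  · refine ContinuousLinearMap.ext fun a => ?_
    simp only [ContinuousLinearMap.comp_sub, ContinuousLinearMap.add_comp, add_apply, sub_apply,
      ContinuousLinearMap.comp_apply, ContinuousLinearMap.coe_fst', ContinuousLinearMap.coe_snd']
    ring

theorem IsSolution.duplicate (hL : ContMDiff I.tangent 𝓘(ℝ, ℝ) 1 L) (hF : IsSmoothForce F)
    (hR : IsRetraction R) (hτ : IsLocalInverse R τ Z U) {h : ℝ} (hh : 0 < h) {c : ℝ → M}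
    (hc : IsSolution L F h c) :
    IsSolution (I := I.prod I) (dupLagrangian L F τ) noForce h fun t => (c t, c t) := by
  have h_velocity : ∀ s ∈ Icc 0 h, velocity (I := I.prod I) h (fun t => (c t, c t)) s
      = tangentIdentity (velocity h c s) := fun s =>
    velocity_eq_tangentIdentity hh hc.contMDiffOn fun _ _ => rfl
  refine ⟨hc.contMDiffOn.prodMk hc.contMDiffOn, fun t ht => ?_⟩
  have h_momentum : (fun s => dVel (localLagrangian (I := I.prod I) (dupLagrangian L F τ)
        (c t, c t)) (localVelocity (I.prod I) h (fun t => (c t, c t)) (c t, c t) s))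
      =ᶠ[𝓝[Icc 0 h] t] fun s => (dVel (localLagrangian L (c t)) (localVelocity I h c (c t) s)).comp
        (ContinuousLinearMap.snd ℝ E E - ContinuousLinearMap.fst ℝ E E) := by
    filter_upwards [self_mem_nhdsWithin, (hc.contMDiffOn t ht).continuousWithinAt.eventually_mem
      (extChartAt_source_mem_nhds (I := I) (c t))] with s hs hs_source
    rw [localVelocity, h_velocity s hs]
    exact dVel_dupLagrangian hL hF hR hτ (v := velocity h c s) hs_source
  have h_force : dPos (localLagrangian (I := I.prod I) (dupLagrangian L F τ) (c t, c t))
        (localVelocity (I.prod I) h (fun t => (c t, c t)) (c t, c t) t)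
      = (dPos (localLagrangian L (c t)) (localVelocity I h c (c t) t)
          + F.toModel (velocity h c t)).comp
          (ContinuousLinearMap.snd ℝ E E - ContinuousLinearMap.fst ℝ E E) := by
    rw [localVelocity, h_velocity t ht]
    exact dPos_dupLagrangian hL hF hR hτ (velocity h c t)
  have h_equation := ((hc.eulerLagrange t ht).clm_comp (hasDerivWithinAt_const t (Icc 0 h)
    (ContinuousLinearMap.snd ℝ E E - ContinuousLinearMap.fst ℝ E E))
    ).congr_of_eventuallyEq_of_mem h_momentum ht
  rw [ContinuousLinearMap.comp_zero, add_zero, ← h_force] at h_equation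
  exact h_equation.congr_deriv (add_zero _).symm

end Duplication

section PartialDifferentials

variable {E : Type*} [NormedAddCommGroup E] [NormedSpace ℝ E]
  {H : Type*} [TopologicalSpace H] {I : ModelWithCorners ℝ E H}
  {M : Type*} [TopologicalSpace M] [ChartedSpace H M]

theorem hasMFDerivAt_prodMk_left (p : M × M) :
    HasMFDerivAt I (I.prod I) (fun x : M => (x, p.2)) p.1 (ContinuousLinearMap.inl ℝ E E) :=
  (hasMFDerivAt_id p.1).prodMk (hasMFDerivAt_const p.2 p.1)

theorem hasMFDerivAt_prodMk_right (p : M × M) :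
    HasMFDerivAt I (I.prod I) (fun x : M => (p.1, x)) p.2 (ContinuousLinearMap.inr ℝ E E) :=
  (hasMFDerivAt_const p.1 p.2).prodMk (hasMFDerivAt_id p.2)

theorem D₁_eq_differential {Ld : M × M → ℝ} {p : M × M}
    (hLd : MDifferentiableAt (I.prod I) 𝓘(ℝ, ℝ) Ld p) (a : E) :
    D₁ I Ld p a = differential (I.prod I) Ld p (a, (0 : E)) :=
  DFunLike.congr_fun
    (HasMFDerivAt.comp p.1 hLd.hasMFDerivAt (hasMFDerivAt_prodMk_left p)).mfderiv a

theorem D₂_eq_differential {Ld : M × M → ℝ} {p : M × M}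
    (hLd : MDifferentiableAt (I.prod I) 𝓘(ℝ, ℝ) Ld p) (b : E) :
    D₂ I Ld p b = differential (I.prod I) Ld p ((0 : E), b) :=
  DFunLike.congr_fun
    (HasMFDerivAt.comp p.2 hLd.hasMFDerivAt (hasMFDerivAt_prodMk_right p)).mfderiv b

end PartialDifferentials

section EndpointFamilies

variable {E : Type*} [NormedAddCommGroup E] [NormedSpace ℝ E]
  {H : Type*} [TopologicalSpace H] {I : ModelWithCorners ℝ E H}
  {M : Type*} [TopologicalSpace M] [ChartedSpace H M]
  {F : Force I M} {h : ℝ} {W : Set (M × M)} {γ : M × M → ℝ → M} {p : M × M}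

namespace IsCurveFamily

theorem exactForceMinus_eq (hγ : IsCurveFamily (I.prod I) I h W γ) (hh : 0 < h) (hp : p ∈ W)
    (a : E) :
    exactForceMinus F h γ p a = ∫ t in (0 : ℝ)..h,
      F.toModel (velocity h (γ p) t) (variation (I.prod I) I γ p t (a, (0 : E))) := by
  refine intervalIntegral.integral_congr fun t ht => ?_
  rw [uIcc_of_le hh.le] at ht
  have h_slice := ((hγ.contMDiffAt_slice hp ht).mdifferentiableAt two_ne_zero).hasMFDerivAt
  exact congrArg (F.toModel (velocity h (γ p) t)) (DFunLike.congr_fun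
    (HasMFDerivAt.comp p.1 h_slice (hasMFDerivAt_prodMk_left p)).mfderiv a)

theorem exactForcePlus_eq (hγ : IsCurveFamily (I.prod I) I h W γ) (hh : 0 < h) (hp : p ∈ W)
    (b : E) :
    exactForcePlus F h γ p b = ∫ t in (0 : ℝ)..h,
      F.toModel (velocity h (γ p) t) (variation (I.prod I) I γ p t ((0 : E), b)) := by
  refine intervalIntegral.integral_congr fun t ht => ?_
  rw [uIcc_of_le hh.le] at ht
  have h_slice := ((hγ.contMDiffAt_slice hp ht).mdifferentiableAt two_ne_zero).hasMFDerivAt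
  exact congrArg (F.toModel (velocity h (γ p) t)) (DFunLike.congr_fun
    (HasMFDerivAt.comp p.2 h_slice (hasMFDerivAt_prodMk_right p)).mfderiv b)

variable [IsManifold I ∞ M]

theorem intervalIntegrable_force_variation (hγ : IsCurveFamily (I.prod I) I h W γ)
    (hF : IsSmoothForce F) (hh : 0 < h) (hp : p ∈ W) (δ : E × E) :
    IntervalIntegrable (fun t => F.toModel (velocity h (γ p) t)
      (variation (I.prod I) I γ p t δ)) MeasureTheory.volume 0 h :=
  (hγ.continuousOn_force_variation hF hh hp δ).intervalIntegrable_of_Icc hh.le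

theorem integral_force_variation (hγ : IsCurveFamily (I.prod I) I h W γ)
    (hF : IsSmoothForce F) (hh : 0 < h) (hp : p ∈ W) (a b : E) :
    ∫ t in (0 : ℝ)..h, F.toModel (velocity h (γ p) t) (variation (I.prod I) I γ p t (a, b))
      = exactForceMinus F h γ p a + exactForcePlus F h γ p b := by
  rw [hγ.exactForceMinus_eq hh hp, hγ.exactForcePlus_eq hh hp, ← intervalIntegral.integral_add
    (hγ.intervalIntegrable_force_variation hF hh hp _)
    (hγ.intervalIntegrable_force_variation hF hh hp _)]
  simp only [← map_add, Prod.mk_add_mk, add_zero, zero_add]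

end IsCurveFamily

end EndpointFamilies

section BoundaryValue

variable {E : Type*} [NormedAddCommGroup E] [NormedSpace ℝ E]
  {H : Type*} [TopologicalSpace H] {I : ModelWithCorners ℝ E H}
  {M : Type*} [TopologicalSpace M] [ChartedSpace H M] [IsManifold I ∞ M]
  {L : TangentBundle I M → ℝ} {F : Force I M} {h : ℝ} {O : Set (TangentBundle I M)}
  {W : Set (M × M)} {γ : M × M → ℝ → M} {p : M × M}

theorem isSmoothForce_noForce : IsSmoothForce (noForce : Force I M) :=
  (contMDiff_zeroSection ℝ (fun q : M => TangentSpace I q →L[ℝ] Trivial M ℝ q)).comp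
    (contMDiff_proj (TangentSpace I))

namespace IsBoundaryValueFamily

theorem isCurveFamily (hγ : IsBoundaryValueFamily L F h O W γ) :
    IsCurveFamily (I.prod I) I h W γ :=
  ⟨hγ.isOpen_endpoints, hγ.contMDiffOn⟩

theorem variation_start (hγ : IsBoundaryValueFamily L F h O W γ) (hp : p ∈ W) :
    variation (I.prod I) I γ p 0 = ContinuousLinearMap.fst ℝ E E := by
  have h_start : (fun x => γ x 0) =ᶠ[𝓝 p] Prod.fst :=
    eventually_of_mem (hγ.isOpen_endpoints.mem_nhds hp) hγ.start
  exact ((hasMFDerivAt_fst p).congr_of_eventuallyEq h_start).mfderiv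

theorem variation_finish (hγ : IsBoundaryValueFamily L F h O W γ) (hp : p ∈ W) :
    variation (I.prod I) I γ p h = ContinuousLinearMap.snd ℝ E E := by
  have h_finish : (fun x => γ x h) =ᶠ[𝓝 p] Prod.snd :=
    eventually_of_mem (hγ.isOpen_endpoints.mem_nhds hp) hγ.finish
  exact ((hasMFDerivAt_snd p).congr_of_eventuallyEq h_finish).mfderiv

variable [I.Boundaryless]

theorem mdifferentiableAt_exactLagrangian (hγ : IsBoundaryValueFamily L F h O W γ) (hh : 0 < h)
    (hp : p ∈ W)
    (hL : ∀ t ∈ Icc 0 h, ContMDiffAt I.tangent 𝓘(ℝ, ℝ) 1 L (velocity h (γ p) t)) :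
    MDifferentiableAt (I.prod I) 𝓘(ℝ, ℝ) (exactLagrangian L h γ) p :=
  hγ.isCurveFamily.mdifferentiableAt_action hh hp hL

theorem differential_exactLagrangian_add_integral_force
    (hγ : IsBoundaryValueFamily L F h O W γ) (hF : IsSmoothForce F) (hh : 0 < h) (hp : p ∈ W)
    (hL : ∀ t ∈ Icc 0 h, ContMDiffAt I.tangent 𝓘(ℝ, ℝ) 1 L (velocity h (γ p) t)) (a b : E) :
    differential (I.prod I) (exactLagrangian L h γ) p (a, b)
        + ∫ t in (0 : ℝ)..h, F.toModel (velocity h (γ p) t)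
            (variation (I.prod I) I γ p t (a, b))
      = fibreDeriv L (velocity h (γ p) h) b - fibreDeriv L (velocity h (γ p) 0) a := by
  have h_action := hγ.isCurveFamily.differential_action_add_integral_force hF hh hp hL
    (hγ.isSolution p hp) (a, b)
  rwa [hγ.variation_start hp, hγ.variation_finish hp] at h_action

theorem differential_exactLagrangian_of_noForce
    (hγ : IsBoundaryValueFamily L noForce h O W γ) (hh : 0 < h) (hp : p ∈ W)
    (hL : ∀ t ∈ Icc 0 h, ContMDiffAt I.tangent 𝓘(ℝ, ℝ) 1 L (velocity h (γ p) t)) (a b : E) :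
    differential (I.prod I) (exactLagrangian L h γ) p (a, b)
      = fibreDeriv L (velocity h (γ p) h) b - fibreDeriv L (velocity h (γ p) 0) a := by
  have h_forced := hγ.differential_exactLagrangian_add_integral_force isSmoothForce_noForce hh hp
    hL a b
  have h_force : ∀ v : TangentBundle I M, (noForce : Force I M).toModel v = 0 := fun _ => rfl
  simpa only [h_force, zero_apply, intervalIntegral.integral_zero, add_zero] using h_forced

theorem D₁_exactLagrangian_add_exactForceMinus (hγ : IsBoundaryValueFamily L F h O W γ)
    (hL : ContMDiff I.tangent 𝓘(ℝ, ℝ) 1 L) (hF : IsSmoothForce F) (hh : 0 < h) (hp : p ∈ W)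
    (a : E) :
    D₁ I (exactLagrangian L h γ) p a + exactForceMinus F h γ p a
      = -fibreDeriv L (velocity h (γ p) 0) a := by
  rw [D₁_eq_differential (hγ.mdifferentiableAt_exactLagrangian hh hp fun _ _ => hL _),
    hγ.isCurveFamily.exactForceMinus_eq hh hp]
  refine (hγ.differential_exactLagrangian_add_integral_force hF hh hp
    (fun _ _ => hL _) a 0).trans ?_
  rw [map_zero, zero_sub]

theorem D₂_exactLagrangian_add_exactForcePlus (hγ : IsBoundaryValueFamily L F h O W γ)
    (hL : ContMDiff I.tangent 𝓘(ℝ, ℝ) 1 L) (hF : IsSmoothForce F) (hh : 0 < h) (hp : p ∈ W)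
    (b : E) :
    D₂ I (exactLagrangian L h γ) p b + exactForcePlus F h γ p b
      = fibreDeriv L (velocity h (γ p) h) b := by
  rw [D₂_eq_differential (hγ.mdifferentiableAt_exactLagrangian hh hp fun _ _ => hL _),
    hγ.isCurveFamily.exactForcePlus_eq hh hp]
  refine (hγ.differential_exactLagrangian_add_integral_force hF hh hp
    (fun _ _ => hL _) 0 b).trans ?_
  rw [map_zero, sub_zero]

theorem forcedDEL_exactLagrangian (hγ : IsBoundaryValueFamily L F h O W γ)
    (hL : ContMDiff I.tangent 𝓘(ℝ, ℝ) 1 L) (hF : IsSmoothForce F) (hh : 0 < h) {x y z : M}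
    (hxy : (x, y) ∈ W) (hyz : (y, z) ∈ W) (δ : E) :
    forcedDEL (I := I) (exactLagrangian L h γ) (exactForceMinus F h γ) (exactForcePlus F h γ)
        x y z δ
      = fibreDeriv L (velocity h (γ (x, y)) h) δ - fibreDeriv L (velocity h (γ (y, z)) 0) δ := by
  have h_start := hγ.D₁_exactLagrangian_add_exactForceMinus hL hF hh hyz δ
  have h_finish := hγ.D₂_exactLagrangian_add_exactForcePlus hL hF hh hxy δ
  unfold forcedDEL
  linarith

end IsBoundaryValueFamily

end BoundaryValue

section PotentialAction

variable {B : Type*} [NormedAddCommGroup B] [NormedSpace ℝ B]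
  {G : Type*} [TopologicalSpace G] {J : ModelWithCorners ℝ B G}
  {N : Type*} [TopologicalSpace N] [ChartedSpace G N]
  {E : Type*} [NormedAddCommGroup E] [NormedSpace ℝ E]
  {H : Type*} [TopologicalSpace H] {I : ModelWithCorners ℝ E H}
  {M : Type*} [TopologicalSpace M] [ChartedSpace H M]
  {h : ℝ} {V : Set N} {ψ : N → ℝ → M × M} {p : N} {c : ℝ → M}

namespace IsCurveFamily

theorem variation_prod (hψ : IsCurveFamily J (I.prod I) h V ψ) (hp : p ∈ V) {t : ℝ}
    (ht : t ∈ Icc 0 h) :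
    variation J (I.prod I) ψ p t
      = (variation J I (fun x t => (ψ x t).1) p t).prod
          (variation J I (fun x t => (ψ x t).2) p t) :=
  mfderiv_prodMk ((hψ.fst.contMDiffAt_slice hp ht).mdifferentiableAt two_ne_zero)
    ((hψ.snd.contMDiffAt_slice hp ht).mdifferentiableAt two_ne_zero)

theorem velocity_eq_tangentIdentity (hψ : IsCurveFamily J (I.prod I) h V ψ) (hh : 0 < h)
    (hp : p ∈ V) (hψc : EqOn (ψ p) (fun t => (c t, c t)) (Icc 0 h)) {t : ℝ} (ht : t ∈ Icc 0 h) :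
    velocity (I := I.prod I) h (ψ p) t = tangentIdentity (velocity h c t) :=
  ForcedLagrangian.velocity_eq_tangentIdentity hh
    ((hψ.fst.contMDiffOn_curve hp).congr fun _ hs => (congrArg Prod.fst (hψc hs)).symm) hψc ht

variable [IsManifold I ∞ M] {F : Force I M} {R : TangentBundle I M → M}
  {τ : ∀ q : M, M → TangentSpace I q} {Z : Set (TangentBundle I M)} {U : Set (M × M)}

theorem contMDiffAt_tangentPotential (hψ : IsCurveFamily J (I.prod I) h V ψ)
    (hF : IsSmoothForce F) (hR : IsRetraction R) (hτ : IsLocalInverse R τ Z U) (hh : 0 < h)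
    (hp : p ∈ V) (hψc : EqOn (ψ p) (fun t => (c t, c t)) (Icc 0 h)) {t : ℝ} (ht : t ∈ Icc 0 h) :
    ContMDiffAt (I.prod I).tangent 𝓘(ℝ, ℝ) 1 (tangentPotential F τ) (velocity h (ψ p) t) := by
  rw [hψ.velocity_eq_tangentIdentity hh hp hψc ht]
  exact (ForcedLagrangian.contMDiffAt_tangentPotential hF hτ (hτ.diag_mem hR _)
    (hτ.diag_mem hR _)).of_le (by simp)

theorem localVelocity_eq_tangentChart (hψ : IsCurveFamily J (I.prod I) h V ψ) (hh : 0 < h)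
    (hp : p ∈ V) (hψc : EqOn (ψ p) (fun t => (c t, c t)) (Icc 0 h)) {t : ℝ} (ht : t ∈ Icc 0 h) :
    localVelocity (I.prod I) h (ψ p) (c t, c t) t
      = tangentChart (I.prod I) (c t, c t) (tangentIdentity (velocity h c t)) :=
  congrArg (tangentChart (I.prod I) (c t, c t)) (hψ.velocity_eq_tangentIdentity hh hp hψc ht)

variable [I.Boundaryless] [J.Boundaryless] [IsManifold J ∞ N]

theorem mdifferentiableAt_action_tangentPotential (hψ : IsCurveFamily J (I.prod I) h V ψ)
    (hF : IsSmoothForce F) (hR : IsRetraction R) (hτ : IsLocalInverse R τ Z U) (hh : 0 < h)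
    (hp : p ∈ V) (hψc : EqOn (ψ p) (fun t => (c t, c t)) (Icc 0 h)) :
    MDifferentiableAt J 𝓘(ℝ, ℝ) (fun x => action (tangentPotential F τ) h (ψ x)) p :=
  hψ.mdifferentiableAt_action hh hp fun _ => hψ.contMDiffAt_tangentPotential hF hR hτ hh hp hψc

theorem differential_action_tangentPotential (hψ : IsCurveFamily J (I.prod I) h V ψ)
    (hF : IsSmoothForce F) (hR : IsRetraction R) (hτ : IsLocalInverse R τ Z U) (hh : 0 < h)
    (hp : p ∈ V) (hψc : EqOn (ψ p) (fun t => (c t, c t)) (Icc 0 h)) (δ : B) :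
    differential J (fun x => action (tangentPotential F τ) h (ψ x)) p δ
      = ∫ t in (0 : ℝ)..h, F.toModel (velocity h c t)
          (variation J I (fun x t => (ψ x t).1) p t δ
            - variation J I (fun x t => (ψ x t).2) p t δ) := by
  have h_dVel : ∀ t ∈ Icc 0 h, dVel (localLagrangian (tangentPotential F τ) (ψ p t))
      (localVelocity (I.prod I) h (ψ p) (ψ p t) t) = 0 := fun t ht => by
    rw [hψc ht, hψ.localVelocity_eq_tangentChart hh hp hψc ht]
    exact dVel_tangentPotential hF hR hτ (velocity h c t)
  refine (hψ.differential_action_of_dVel_eq_zero hh hp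
    (fun _ => hψ.contMDiffAt_tangentPotential hF hR hτ hh hp hψc) h_dVel δ).trans
    (intervalIntegral.integral_congr fun t ht => ?_)
  rw [uIcc_of_le hh.le] at ht
  have h_dPos : dPos (localLagrangian (tangentPotential F τ) (ψ p t))
      (localVelocity (I.prod I) h (ψ p) (ψ p t) t)
        = (F.toModel (velocity h c t)).comp
            (ContinuousLinearMap.fst ℝ E E - ContinuousLinearMap.snd ℝ E E) := by
    rw [hψc ht, hψ.localVelocity_eq_tangentChart hh hp hψc ht]
    exact dPos_tangentPotential hF hR hτ (velocity h c t)
  simp only [h_dPos, hψ.variation_prod hp ht]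
  rfl

end IsCurveFamily

end PotentialAction

section ExactPotential

variable {E : Type*} [NormedAddCommGroup E] [NormedSpace ℝ E]
  {H : Type*} [TopologicalSpace H] {I : ModelWithCorners ℝ E H}
  {M : Type*} [TopologicalSpace M] [ChartedSpace H M]
  {h : ℝ} {V : Set ((M × M) × (M × M))} {Γ : (M × M) × (M × M) → ℝ → M × M}
  {P : (M × M) × (M × M)} {c : ℝ → M} {F : Force I M} {R : TangentBundle I M → M}
  {τ : ∀ q : M, M → TangentSpace I q} {Z : Set (TangentBundle I M)} {U : Set (M × M)}

namespace IsCurveFamily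

theorem exactPotential_eq_action
    (hΓ : IsCurveFamily ((I.prod I).prod (I.prod I)) (I.prod I) h V Γ) (hh : 0 < h) (hP : P ∈ V) :
    exactPotential F τ h Γ P = action (tangentPotential F τ) h (Γ P) := by
  refine intervalIntegral.integral_congr fun t ht => ?_
  rw [uIcc_of_le hh.le] at ht
  have h_velocity : velocity (I := I.prod I) h (Γ P) t = _ :=
    velocity_prodMk hh ht (hΓ.fst.mdifferentiableWithinAt_curve hP ht)
      (hΓ.snd.mdifferentiableWithinAt_curve hP ht)
  simp only [h_velocity, tangentPotential, Equiv.apply_symm_apply]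

theorem exactPotential_eventuallyEq
    (hΓ : IsCurveFamily ((I.prod I).prod (I.prod I)) (I.prod I) h V Γ) (hh : 0 < h) (hP : P ∈ V) :
    exactPotential F τ h Γ =ᶠ[𝓝 P] fun x => action (tangentPotential F τ) h (Γ x) := by
  filter_upwards [hΓ.isOpen.mem_nhds hP] with x hx using hΓ.exactPotential_eq_action hh hx

variable [IsManifold I ∞ M] [I.Boundaryless]

theorem mdifferentiableAt_exactPotential
    (hΓ : IsCurveFamily ((I.prod I).prod (I.prod I)) (I.prod I) h V Γ) (hF : IsSmoothForce F)
    (hR : IsRetraction R) (hτ : IsLocalInverse R τ Z U) (hh : 0 < h) (hP : P ∈ V)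
    (hΓc : EqOn (Γ P) (fun t => (c t, c t)) (Icc 0 h)) :
    MDifferentiableAt ((I.prod I).prod (I.prod I)) 𝓘(ℝ, ℝ) (exactPotential F τ h Γ) P :=
  (hΓ.mdifferentiableAt_action_tangentPotential hF hR hτ hh hP hΓc).congr_of_eventuallyEq
    (hΓ.exactPotential_eventuallyEq hh hP)

theorem differential_exactPotential
    (hΓ : IsCurveFamily ((I.prod I).prod (I.prod I)) (I.prod I) h V Γ) (hF : IsSmoothForce F)
    (hR : IsRetraction R) (hτ : IsLocalInverse R τ Z U) (hh : 0 < h) (hP : P ∈ V)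
    (hΓc : EqOn (Γ P) (fun t => (c t, c t)) (Icc 0 h)) (Δ : (E × E) × (E × E)) :
    differential ((I.prod I).prod (I.prod I)) (exactPotential F τ h Γ) P Δ
      = ∫ t in (0 : ℝ)..h, F.toModel (velocity h c t)
          (variationFst I Γ P t Δ - variationSnd I Γ P t Δ) :=
  (DFunLike.congr_fun (hΓ.exactPotential_eventuallyEq hh hP).mfderiv_eq Δ).trans
    (hΓ.differential_action_tangentPotential hF hR hτ hh hP hΓc Δ)

end IsCurveFamily

end ExactPotential

section PairPotential

variable {E : Type*} [NormedAddCommGroup E] [NormedSpace ℝ E]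
  {H : Type*} [TopologicalSpace H] {I : ModelWithCorners ℝ E H}
  {M : Type*} [TopologicalSpace M] [ChartedSpace H M]
  {h : ℝ} {W : Set (M × M)} {γ : M × M → ℝ → M} {p : M × M}

/-- The family `((q₀, Q₀), (q₁, Q₁)) ↦ (γ(q₀, q₁), γ(Q₀, Q₁))` of curves in `M × M` along which
`pairPotential` integrates `K̃_F`. -/
def duplicateFamily (γ : M × M → ℝ → M) (P : (M × M) × (M × M)) (t : ℝ) : M × M :=
  (γ (P.1.1, P.2.1) t, γ (P.1.2, P.2.2) t)

theorem hasMFDerivAt_fst_fst_prodMk_snd_fst (P : (M × M) × (M × M)) :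
    HasMFDerivAt ((I.prod I).prod (I.prod I)) (I.prod I)
      (fun P : (M × M) × (M × M) => (P.1.1, P.2.1)) P
      ((ContinuousLinearMap.fst ℝ E E).prodMap (ContinuousLinearMap.fst ℝ E E)) :=
  ((hasMFDerivAt_fst P.1).comp P (hasMFDerivAt_fst P)).prodMk
    ((hasMFDerivAt_fst P.2).comp P (hasMFDerivAt_snd P))

theorem hasMFDerivAt_fst_snd_prodMk_snd_snd (P : (M × M) × (M × M)) :
    HasMFDerivAt ((I.prod I).prod (I.prod I)) (I.prod I)
      (fun P : (M × M) × (M × M) => (P.1.2, P.2.2)) P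
      ((ContinuousLinearMap.snd ℝ E E).prodMap (ContinuousLinearMap.snd ℝ E E)) :=
  ((hasMFDerivAt_snd P.1).comp P (hasMFDerivAt_fst P)).prodMk
    ((hasMFDerivAt_snd P.2).comp P (hasMFDerivAt_snd P))

namespace IsCurveFamily

theorem duplicateFamily (hγ : IsCurveFamily (I.prod I) I h W γ) :
    IsCurveFamily ((I.prod I).prod (I.prod I)) (I.prod I) h
      {P : (M × M) × (M × M) | (P.1.1, P.2.1) ∈ W ∧ (P.1.2, P.2.2) ∈ W} (duplicateFamily γ) := by
  have h_fst : ContMDiff ((I.prod I).prod (I.prod I)) (I.prod I) 2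
      (fun P : (M × M) × (M × M) => (P.1.1, P.2.1)) :=
    (contMDiff_fst.comp contMDiff_fst).prodMk (contMDiff_fst.comp contMDiff_snd)
  have h_snd : ContMDiff ((I.prod I).prod (I.prod I)) (I.prod I) 2
      (fun P : (M × M) × (M × M) => (P.1.2, P.2.2)) :=
    (contMDiff_snd.comp contMDiff_fst).prodMk (contMDiff_snd.comp contMDiff_snd)
  have h_open := (hγ.isOpen.preimage h_fst.continuous).inter (hγ.isOpen.preimage h_snd.continuous)
  exact (hγ.comp h_open h_fst.contMDiffOn fun _ hP => hP.1).prodMk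
    (hγ.comp h_open h_snd.contMDiffOn fun _ hP => hP.2)

theorem variationFst_duplicateFamily (hγ : IsCurveFamily (I.prod I) I h W γ) (hp : p ∈ W) {t : ℝ}
    (ht : t ∈ Icc 0 h) (Δ : (E × E) × (E × E)) :
    variationFst I (ForcedLagrangian.duplicateFamily γ) (discreteIdentity p) t Δ
      = variation (I.prod I) I γ p t (Δ.1.1, Δ.2.1) := by
  have h_slice := ((hγ.contMDiffAt_slice hp ht).mdifferentiableAt two_ne_zero).hasMFDerivAt
  exact DFunLike.congr_fun (HasMFDerivAt.comp (g := fun x => γ x t) (discreteIdentity p) h_slice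
    (hasMFDerivAt_fst_fst_prodMk_snd_fst _)).mfderiv Δ

theorem variationSnd_duplicateFamily (hγ : IsCurveFamily (I.prod I) I h W γ) (hp : p ∈ W) {t : ℝ}
    (ht : t ∈ Icc 0 h) (Δ : (E × E) × (E × E)) :
    variationSnd I (ForcedLagrangian.duplicateFamily γ) (discreteIdentity p) t Δ
      = variation (I.prod I) I γ p t (Δ.1.2, Δ.2.2) := by
  have h_slice := ((hγ.contMDiffAt_slice hp ht).mdifferentiableAt two_ne_zero).hasMFDerivAt
  exact DFunLike.congr_fun (HasMFDerivAt.comp (g := fun x => γ x t) (discreteIdentity p) h_slice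
    (hasMFDerivAt_fst_snd_prodMk_snd_snd _)).mfderiv Δ

variable [IsManifold I ∞ M] [I.Boundaryless] {F : Force I M} {R : TangentBundle I M → M}
  {τ : ∀ q : M, M → TangentSpace I q} {Z : Set (TangentBundle I M)} {U : Set (M × M)}

theorem mdifferentiableAt_pairPotential (hγ : IsCurveFamily (I.prod I) I h W γ)
    (hF : IsSmoothForce F) (hR : IsRetraction R) (hτ : IsLocalInverse R τ Z U) (hh : 0 < h)
    (hp : p ∈ W) :
    MDifferentiableAt ((I.prod I).prod (I.prod I)) 𝓘(ℝ, ℝ) (pairPotential F τ h γ)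
      (discreteIdentity p) :=
  hγ.duplicateFamily.mdifferentiableAt_exactPotential (c := γ p) hF hR hτ hh ⟨hp, hp⟩
    fun _ _ => rfl

theorem differential_pairPotential (hγ : IsCurveFamily (I.prod I) I h W γ)
    (hF : IsSmoothForce F) (hR : IsRetraction R) (hτ : IsLocalInverse R τ Z U) (hh : 0 < h)
    (hp : p ∈ W) (a A b B : E) :
    differential ((I.prod I).prod (I.prod I)) (pairPotential F τ h γ) (discreteIdentity p)
        ((a, A), (b, B))
      = (exactForceMinus F h γ p a + exactForcePlus F h γ p b)
        - (exactForceMinus F h γ p A + exactForcePlus F h γ p B) := by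
  rw [← hγ.integral_force_variation hF hh hp, ← hγ.integral_force_variation hF hh hp,
    ← intervalIntegral.integral_sub (hγ.intervalIntegrable_force_variation hF hh hp _)
      (hγ.intervalIntegrable_force_variation hF hh hp _)]
  refine (hγ.duplicateFamily.differential_exactPotential (c := γ p) hF hR hτ hh ⟨hp, hp⟩
    (fun _ _ => rfl) ((a, A), (b, B))).trans (intervalIntegral.integral_congr fun t ht => ?_)
  rw [uIcc_of_le hh.le] at ht
  simp only [hγ.variationFst_duplicateFamily hp ht, hγ.variationSnd_duplicateFamily hp ht, map_sub]

end IsCurveFamily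

end PairPotential

theorem forall_prod_eq_zero_iff_of_eq_sub {X A : Type*} [Zero X] [AddGroup A] {f : X × X → A}
    {g : X → A} (hfg : ∀ x y, f (x, y) = g y - g x) (hg : g 0 = 0) :
    (∀ z, f z = 0) ↔ ∀ x, g x = 0 := by
  refine ⟨fun hf y => ?_, fun hg' z => ?_⟩
  · simpa only [hfg, hg, sub_zero] using hf (0, y)
  · rw [← Prod.mk.eta (p := z), hfg, hg', hg', sub_zero]

section DuplicatedBoundaryValue

variable {E : Type*} [NormedAddCommGroup E] [NormedSpace ℝ E]
  {H : Type*} [TopologicalSpace H] {I : ModelWithCorners ℝ E H}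
  {M : Type*} [TopologicalSpace M] [ChartedSpace H M] [IsManifold I ∞ M]
  {L : TangentBundle I M → ℝ} {F : Force I M} {R : TangentBundle I M → M}
  {τ : ∀ q : M, M → TangentSpace I q} {Z : Set (TangentBundle I M)} {U : Set (M × M)}
  {h : ℝ} {O : Set (TangentBundle I M)} {W : Set (M × M)} {γ : M × M → ℝ → M}
  {O₂ : Set (TangentBundle (I.prod I) (M × M))} {W₂ : Set ((M × M) × (M × M))}
  {Γ : (M × M) × (M × M) → ℝ → M × M} {P : (M × M) × (M × M)} {c c' : ℝ → M}

namespace IsBoundaryValueFamily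

theorem exactLagrangian_dupLagrangian_eq_zero
    (hΓ : IsBoundaryValueFamily (dupLagrangian L F τ) noForce h O₂ W₂ Γ) (hR : IsRetraction R)
    (hτ : IsLocalInverse R τ Z U) (hh : 0 < h) (hP : P ∈ W₂)
    (hc : EqOn (Γ P) (fun t => (c t, c t)) (Icc 0 h)) :
    exactLagrangian (dupLagrangian L F τ) h Γ P = 0 := by
  refine (intervalIntegral.integral_congr fun t ht => ?_).trans intervalIntegral.integral_zero
  rw [uIcc_of_le hh.le] at ht
  simp only [hΓ.isCurveFamily.velocity_eq_tangentIdentity hh hP hc ht,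
    dupLagrangian_tangentIdentity hR hτ]

theorem contMDiffAt_dupLagrangian
    (hΓ : IsBoundaryValueFamily (dupLagrangian L F τ) noForce h O₂ W₂ Γ)
    (hL : ContMDiff I.tangent 𝓘(ℝ, ℝ) 1 L) (hF : IsSmoothForce F) (hR : IsRetraction R)
    (hτ : IsLocalInverse R τ Z U) (hh : 0 < h) (hP : P ∈ W₂)
    (hc : EqOn (Γ P) (fun t => (c t, c t)) (Icc 0 h)) {t : ℝ} (ht : t ∈ Icc 0 h) :
    ContMDiffAt (I.prod I).tangent 𝓘(ℝ, ℝ) 1 (dupLagrangian L F τ) (velocity h (Γ P) t) := by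
  rw [hΓ.isCurveFamily.velocity_eq_tangentIdentity hh hP hc ht]
  exact ForcedLagrangian.contMDiffAt_dupLagrangian hL hF hτ (hτ.diag_mem hR _) (hτ.diag_mem hR _)

variable [I.Boundaryless]

theorem eqOn_discreteIdentity (hγ : IsBoundaryValueFamily L F h O W γ)
    (hΓ : IsBoundaryValueFamily (dupLagrangian L F τ) noForce h O₂ W₂ Γ)
    (hL : ContMDiff I.tangent 𝓘(ℝ, ℝ) 1 L) (hF : IsSmoothForce F) (hR : IsRetraction R)
    (hτ : IsLocalInverse R τ Z U) (hh : 0 < h) (hO₂ : ∀ v ∈ O, tangentIdentity v ∈ O₂)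
    {p : M × M} (hp : p ∈ W) (hp₂ : discreteIdentity p ∈ W₂) :
    EqOn (Γ (discreteIdentity p)) (fun t => (γ p t, γ p t)) (Icc 0 h) := by
  have h_sol := hγ.isSolution p hp
  have h_start : (γ p 0, γ p 0) = (discreteIdentity p).1 := by rw [hγ.start p hp]; rfl
  have h_finish : (γ p h, γ p h) = (discreteIdentity p).2 := by rw [hγ.finish p hp]; rfl
  refine (hΓ.unique _ hp₂ _ (h_sol.duplicate hL hF hR hτ hh) h_start h_finish fun t ht => ?_).symm
  rw [velocity_eq_tangentIdentity hh h_sol.contMDiffOn (fun _ _ => rfl) ht]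
  exact hO₂ _ (hγ.velocity_mem p hp t ht)

theorem mdifferentiableAt_exactLagrangian_dupLagrangian
    (hΓ : IsBoundaryValueFamily (dupLagrangian L F τ) noForce h O₂ W₂ Γ)
    (hL : ContMDiff I.tangent 𝓘(ℝ, ℝ) 1 L) (hF : IsSmoothForce F) (hR : IsRetraction R)
    (hτ : IsLocalInverse R τ Z U) (hh : 0 < h) (hP : P ∈ W₂)
    (hc : EqOn (Γ P) (fun t => (c t, c t)) (Icc 0 h)) :
    MDifferentiableAt ((I.prod I).prod (I.prod I)) 𝓘(ℝ, ℝ)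
      (exactLagrangian (dupLagrangian L F τ) h Γ) P :=
  hΓ.mdifferentiableAt_exactLagrangian hh hP fun _ =>
    hΓ.contMDiffAt_dupLagrangian hL hF hR hτ hh hP hc

theorem differential_exactLagrangian_dupLagrangian
    (hΓ : IsBoundaryValueFamily (dupLagrangian L F τ) noForce h O₂ W₂ Γ)
    (hL : ContMDiff I.tangent 𝓘(ℝ, ℝ) 1 L) (hF : IsSmoothForce F) (hR : IsRetraction R)
    (hτ : IsLocalInverse R τ Z U) (hh : 0 < h) (hP : P ∈ W₂)
    (hc : EqOn (Γ P) (fun t => (c t, c t)) (Icc 0 h)) (a A b B : E) :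
    differential ((I.prod I).prod (I.prod I)) (exactLagrangian (dupLagrangian L F τ) h Γ) P
        ((a, A), (b, B))
      = fibreDeriv L (velocity h c h) (B - b) - fibreDeriv L (velocity h c 0) (A - a) := by
  have h_momentum : ∀ t ∈ Icc 0 h, fibreDeriv (dupLagrangian L F τ) (velocity h (Γ P) t)
      = (fibreDeriv L (velocity h c t)).comp
          (ContinuousLinearMap.snd ℝ E E - ContinuousLinearMap.fst ℝ E E) := fun t ht => by
    rw [hΓ.isCurveFamily.velocity_eq_tangentIdentity hh hP hc ht]
    exact fibreDeriv_dupLagrangian hL hR hτ (velocity h c t)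
  refine (hΓ.differential_exactLagrangian_of_noForce hh hP
    (fun _ => hΓ.contMDiffAt_dupLagrangian hL hF hR hτ hh hP hc) (a, A) (b, B)).trans ?_
  rw [h_momentum h (right_mem_Icc.2 hh.le), h_momentum 0 (left_mem_Icc.2 hh.le)]
  rfl

theorem freeDEL_exactLagrangian_dupLagrangian
    (hΓ : IsBoundaryValueFamily (dupLagrangian L F τ) noForce h O₂ W₂ Γ)
    (hL : ContMDiff I.tangent 𝓘(ℝ, ℝ) 1 L) (hF : IsSmoothForce F) (hR : IsRetraction R)
    (hτ : IsLocalInverse R τ Z U) (hh : 0 < h) {x y z : M × M} (hxy : (x, y) ∈ W₂)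
    (hyz : (y, z) ∈ W₂) (hc : EqOn (Γ (x, y)) (fun t => (c t, c t)) (Icc 0 h))
    (hc' : EqOn (Γ (y, z)) (fun t => (c' t, c' t)) (Icc 0 h)) (a A : E) :
    freeDEL (I.prod I) (exactLagrangian (dupLagrangian L F τ) h Γ) x y z (a, A)
      = fibreDeriv L (velocity h c h) (A - a) - fibreDeriv L (velocity h c' 0) (A - a) := by
  have h_start := (D₁_eq_differential (hΓ.mdifferentiableAt_exactLagrangian_dupLagrangian
    hL hF hR hτ hh hyz hc') (a, A)).trans
      (hΓ.differential_exactLagrangian_dupLagrangian hL hF hR hτ hh hyz hc' a A 0 0)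
  have h_finish := (D₂_eq_differential (hΓ.mdifferentiableAt_exactLagrangian_dupLagrangian
    hL hF hR hτ hh hxy hc) (a, A)).trans
      (hΓ.differential_exactLagrangian_dupLagrangian hL hF hR hτ hh hxy hc 0 0 a A)
  rw [sub_self, map_zero, zero_sub] at h_start
  rw [sub_self, map_zero, sub_zero] at h_finish
  unfold freeDEL
  linarith

theorem differential_exactLagrangian_dupLagrangian_discreteIdentity
    (hΓ : IsBoundaryValueFamily (dupLagrangian L F τ) noForce h O₂ W₂ Γ)
    (hγ : IsBoundaryValueFamily L F h O W γ) (hL : ContMDiff I.tangent 𝓘(ℝ, ℝ) 1 L)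
    (hF : IsSmoothForce F) (hR : IsRetraction R) (hτ : IsLocalInverse R τ Z U) (hh : 0 < h)
    {p : M × M} (hp : p ∈ W) (hp₂ : discreteIdentity p ∈ W₂)
    (h_diag : EqOn (Γ (discreteIdentity p)) (fun t => (γ p t, γ p t)) (Icc 0 h)) (a A b B : E) :
    differential ((I.prod I).prod (I.prod I)) (exactLagrangian (dupLagrangian L F τ) h Γ)
        (discreteIdentity p) ((a, A), (b, B))
      = (D₁ I (exactLagrangian L h γ) p A + exactForceMinus F h γ p A
          + D₂ I (exactLagrangian L h γ) p B + exactForcePlus F h γ p B)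
        - (D₁ I (exactLagrangian L h γ) p a + exactForceMinus F h γ p a
          + D₂ I (exactLagrangian L h γ) p b + exactForcePlus F h γ p b) := by
  refine (hΓ.differential_exactLagrangian_dupLagrangian hL hF hR hτ hh hp₂ h_diag a A b B).trans ?_
  have h_minus := hγ.D₁_exactLagrangian_add_exactForceMinus hL hF hh hp
  have h_plus := hγ.D₂_exactLagrangian_add_exactForcePlus hL hF hh hp
  rw [map_sub, map_sub]
  linarith [h_minus a, h_minus A, h_plus b, h_plus B]

theorem freeDEL_exactLagrangian_dupLagrangian_diag
    (hΓ : IsBoundaryValueFamily (dupLagrangian L F τ) noForce h O₂ W₂ Γ)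
    (hγ : IsBoundaryValueFamily L F h O W γ) (hL : ContMDiff I.tangent 𝓘(ℝ, ℝ) 1 L)
    (hF : IsSmoothForce F) (hR : IsRetraction R) (hτ : IsLocalInverse R τ Z U) (hh : 0 < h)
    (hW₂ : ∀ p ∈ W, discreteIdentity p ∈ W₂)
    (h_diag : ∀ p ∈ W, EqOn (Γ (discreteIdentity p)) (fun t => (γ p t, γ p t)) (Icc 0 h))
    {x y z : M} (hxy : (x, y) ∈ W) (hyz : (y, z) ∈ W) (a A : E) :
    freeDEL (I.prod I) (exactLagrangian (dupLagrangian L F τ) h Γ) (x, x) (y, y) (z, z) (a, A)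
      = forcedDEL (I := I) (exactLagrangian L h γ) (exactForceMinus F h γ)
          (exactForcePlus F h γ) x y z A
        - forcedDEL (I := I) (exactLagrangian L h γ) (exactForceMinus F h γ)
          (exactForcePlus F h γ) x y z a := by
  refine (hΓ.freeDEL_exactLagrangian_dupLagrangian hL hF hR hτ hh (hW₂ _ hxy) (hW₂ _ hyz)
    (h_diag _ hxy) (h_diag _ hyz) a A).trans ?_
  rw [map_sub, map_sub, hγ.forcedDEL_exactLagrangian hL hF hh hxy hyz,
    hγ.forcedDEL_exactLagrangian hL hF hh hxy hyz]
  ring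

theorem forall_freeDEL_diag_eq_zero_iff
    (hΓ : IsBoundaryValueFamily (dupLagrangian L F τ) noForce h O₂ W₂ Γ)
    (hγ : IsBoundaryValueFamily L F h O W γ) (hL : ContMDiff I.tangent 𝓘(ℝ, ℝ) 1 L)
    (hF : IsSmoothForce F) (hR : IsRetraction R) (hτ : IsLocalInverse R τ Z U) (hh : 0 < h)
    (hW₂ : ∀ p ∈ W, discreteIdentity p ∈ W₂)
    (h_diag : ∀ p ∈ W, EqOn (Γ (discreteIdentity p)) (fun t => (γ p t, γ p t)) (Icc 0 h))
    {x y z : M} (hxy : (x, y) ∈ W) (hyz : (y, z) ∈ W) :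
    (∀ δ : E × E, freeDEL (I.prod I) (exactLagrangian (dupLagrangian L F τ) h Γ)
        (x, x) (y, y) (z, z) δ = 0)
      ↔ ∀ δ : E, forcedDEL (I := I) (exactLagrangian L h γ) (exactForceMinus F h γ)
          (exactForcePlus F h γ) x y z δ = 0 := by
  refine forall_prod_eq_zero_iff_of_eq_sub
    (hΓ.freeDEL_exactLagrangian_dupLagrangian_diag hγ hL hF hR hτ hh hW₂ h_diag hxy hyz) ?_
  rw [hγ.forcedDEL_exactLagrangian hL hF hh hxy hyz, map_zero, map_zero, sub_zero]

end IsBoundaryValueFamily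

end DuplicatedBoundaryValue

end ForcedLagrangian

end

theorem mainTheorem9_general
    {E : Type*} [NormedAddCommGroup E] [NormedSpace ℝ E]
    {H : Type*} [TopologicalSpace H] {I : ModelWithCorners ℝ E H} [I.Boundaryless]
    {Q : Type*} [TopologicalSpace Q] [ChartedSpace H Q] [IsManifold I ∞ Q]
    (L : TangentBundle I Q → ℝ) (hL : ContMDiff I.tangent 𝓘(ℝ, ℝ) 1 L)
    (F : Force I Q) (hF : IsSmoothForce F)
    (R : TangentBundle I Q → Q) (hR : IsRetraction R)
    (τ : ∀ q : Q, Q → TangentSpace I q)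
    (Z : Set (TangentBundle I Q)) (U : Set (Q × Q)) (hτ : IsLocalInverse R τ Z U)
    (h : ℝ) (hh : 0 < h)
    (O : Set (TangentBundle I Q)) (W : Set (Q × Q)) (γ : Q × Q → ℝ → Q)
    (hγ : IsBoundaryValueFamily L F h O W γ)
    (O₂ : Set (TangentBundle (I.prod I) (Q × Q)))
    (W₂ : Set ((Q × Q) × (Q × Q))) (Γ : (Q × Q) × (Q × Q) → ℝ → Q × Q)
    (hΓ : IsBoundaryValueFamily (dupLagrangian L F τ) noForce h O₂ W₂ Γ)
    (hO₂ : ∀ v ∈ O, tangentIdentity v ∈ O₂) (hW₂ : ∀ p ∈ W, discreteIdentity p ∈ W₂) :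
    (∀ p ∈ W,
      (∀ t ∈ Set.Icc (0 : ℝ) h,
        Γ (discreteIdentity p) t = (γ p t, γ p t)) ∧
      exactLagrangian (dupLagrangian L F τ) h Γ
        (discreteIdentity p) = 0 ∧
      MDifferentiableAt (I.prod I) 𝓘(ℝ, ℝ)
        (exactLagrangian L h γ) p ∧
      MDifferentiableAt ((I.prod I).prod (I.prod I)) 𝓘(ℝ, ℝ)
        (exactLagrangian (dupLagrangian L F τ) h Γ)
        (discreteIdentity p) ∧
      (∀ (a A : TangentSpace I p.1) (b B : TangentSpace I p.2),
        differential ((I.prod I).prod (I.prod I))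
          (exactLagrangian (dupLagrangian L F τ) h Γ)
          (discreteIdentity p) ((a, A), (b, B)) =
        (D₁ I (exactLagrangian L h γ) p A
            + exactForceMinus F h γ p A
          + D₂ I (exactLagrangian L h γ) p B
            + exactForcePlus F h γ p B)
        - (D₁ I (exactLagrangian L h γ) p a
            + exactForceMinus F h γ p a
          + D₂ I (exactLagrangian L h γ) p b
            + exactForcePlus F h γ p b)) ∧
      MDifferentiableAt ((I.prod I).prod (I.prod I)) 𝓘(ℝ, ℝ)
        (pairPotential F τ h γ) (discreteIdentity p) ∧
      (∀ (a A : TangentSpace I p.1) (b B : TangentSpace I p.2),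
        differential ((I.prod I).prod (I.prod I))
          (pairPotential F τ h γ)
          (discreteIdentity p) ((a, A), (b, B)) =
        (exactForceMinus F h γ p a + exactForcePlus F h γ p b)
        - (exactForceMinus F h γ p A
            + exactForcePlus F h γ p B)) ∧
      MDifferentiableAt ((I.prod I).prod (I.prod I)) 𝓘(ℝ, ℝ)
        (exactPotential F τ h Γ) (discreteIdentity p) ∧
      (∀ Δ : TangentSpace ((I.prod I).prod (I.prod I))
          (discreteIdentity p),
        differential ((I.prod I).prod (I.prod I))
          (exactPotential F τ h Γ) (discreteIdentity p) Δ =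
        ∫ t in (0 : ℝ)..h, F.toModel (velocity h (γ p) t)
          (variationFst I Γ (discreteIdentity p) t Δ
            - variationSnd I Γ (discreteIdentity p) t Δ))) ∧
    (∀ x y z : Q, (x, y) ∈ W → (y, z) ∈ W → ∀ a A : TangentSpace I y,
      freeDEL (I.prod I)
        (exactLagrangian (dupLagrangian L F τ) h Γ)
        (x, x) (y, y) (z, z) (a, A) =
      forcedDEL (exactLagrangian L h γ)
          (exactForceMinus F h γ) (exactForcePlus F h γ) x y z A
      - forcedDEL (exactLagrangian L h γ)
          (exactForceMinus F h γ) (exactForcePlus F h γ)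
          x y z a) ∧
    (∀ (n : ℕ) (q : ℕ → Q), (∀ k < n, (q k, q (k + 1)) ∈ W) →
      ((∀ k, k + 2 ≤ n → ∀ δ : TangentSpace (I.prod I) (q (k + 1), q (k + 1)),
        freeDEL (I.prod I)
          (exactLagrangian (dupLagrangian L F τ) h Γ)
          (q k, q k) (q (k + 1), q (k + 1)) (q (k + 2), q (k + 2)) δ = 0) ↔
      (∀ k, k + 2 ≤ n → ∀ δ : TangentSpace I (q (k + 1)),
        forcedDEL (exactLagrangian L h γ)
          (exactForceMinus F h γ) (exactForcePlus F h γ)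
          (q k) (q (k + 1)) (q (k + 2)) δ = 0))) := by
  have h_diag : ∀ p ∈ W, EqOn (Γ (discreteIdentity p)) (fun t => (γ p t, γ p t)) (Icc 0 h) :=
    fun p hp => hγ.eqOn_discreteIdentity hΓ hL hF hR hτ hh hO₂ hp (hW₂ p hp)
  refine ⟨fun p hp => ⟨h_diag p hp, ?_, ?_, ?_, ?_, ?_, ?_, ?_, ?_⟩, fun x y z => ?_,
    fun n q hq => ?_⟩
  · exact hΓ.exactLagrangian_dupLagrangian_eq_zero hR hτ hh (hW₂ p hp) (h_diag p hp)
  · exact hγ.mdifferentiableAt_exactLagrangian hh hp fun _ _ => hL _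
  · exact hΓ.mdifferentiableAt_exactLagrangian_dupLagrangian hL hF hR hτ hh (hW₂ p hp) (h_diag p hp)
  · exact hΓ.differential_exactLagrangian_dupLagrangian_discreteIdentity hγ hL hF hR hτ hh hp
      (hW₂ p hp) (h_diag p hp)
  · exact hγ.isCurveFamily.mdifferentiableAt_pairPotential hF hR hτ hh hp
  · exact hγ.isCurveFamily.differential_pairPotential hF hR hτ hh hp
  · exact hΓ.isCurveFamily.mdifferentiableAt_exactPotential hF hR hτ hh (hW₂ p hp) (h_diag p hp)
  · exact hΓ.isCurveFamily.differential_exactPotential hF hR hτ hh (hW₂ p hp) (h_diag p hp)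
  · exact hΓ.freeDEL_exactLagrangian_dupLagrangian_diag hγ hL hF hR hτ hh hW₂ h_diag
  · exact forall₂_congr fun k hk => hΓ.forall_freeDEL_diag_eq_zero_iff hγ hL hF hR hτ hh hW₂ h_diag
      (hq k (by lia)) (hq (k + 1) (by lia))

theorem mainTheorem9
    {E : Type*} [NormedAddCommGroup E] [NormedSpace ℝ E] [FiniteDimensional ℝ E]
    {Q : Type*} [TopologicalSpace Q] [T2Space Q] [SecondCountableTopology Q]
    [ChartedSpace E Q] [IsManifold 𝓘(ℝ, E) ∞ Q]
    -- the regular forced Lagrangian system `(L, F)`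
    (L : TangentBundle 𝓘(ℝ, E) Q → ℝ)
    (hL : ContMDiff 𝓘(ℝ, E).tangent 𝓘(ℝ, ℝ) ∞ L)
    (hreg : IsRegularLagrangian L)
    (F : Force 𝓘(ℝ, E) Q)
    (hF : IsSmoothForce F)
    -- the retraction and the local inverse `τ` that define `K̃_F`
    (R : TangentBundle 𝓘(ℝ, E) Q → Q)
    (hR : IsRetraction R)
    (τ : ∀ q : Q, Q → TangentSpace 𝓘(ℝ, E) q)
    (Z : Set (TangentBundle 𝓘(ℝ, E) Q)) (U : Set (Q × Q))
    (hτ : IsLocalInverse R τ Z U)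
    (h : ℝ) (hh : 0 < h)
    -- the boundary value problem of the forced system
    (O : Set (TangentBundle 𝓘(ℝ, E) Q)) (W : Set (Q × Q)) (γ : Q × Q → ℝ → Q)
    (hγ : IsBoundaryValueFamily L F h O W γ)
    -- the boundary value problem of the duplicated system, around the identities
    (O₂ : Set (TangentBundle (𝓘(ℝ, E).prod 𝓘(ℝ, E)) (Q × Q)))
    (W₂ : Set ((Q × Q) × (Q × Q))) (Γ : (Q × Q) × (Q × Q) → ℝ → Q × Q)
    (hΓ : IsBoundaryValueFamily (dupLagrangian L F τ)
      noForce h O₂ W₂ Γ)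
    (hO₂ : ∀ v ∈ O, tangentIdentity v ∈ O₂)
    (hW₂ : ∀ p ∈ W, discreteIdentity p ∈ W₂)
    (hU : ∀ w ∈ O₂, (w.proj.1, w.proj.2) ∈ U ∧ (w.proj.2, w.proj.1) ∈ U) :
    (∀ p ∈ W,
      -- at the identities the duplicated solution is two copies of the forced one
      (∀ t ∈ Set.Icc (0 : ℝ) h,
        Γ (discreteIdentity p) t = (γ p t, γ p t)) ∧
      exactLagrangian (dupLagrangian L F τ) h Γ
        (discreteIdentity p) = 0 ∧
      -- the differential at the identities is two copies, with opposite signs, of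
      -- `dL_d^e + f_d^{e-} + f_d^{e+}`
      MDifferentiableAt (𝓘(ℝ, E).prod 𝓘(ℝ, E)) 𝓘(ℝ, ℝ)
        (exactLagrangian L h γ) p ∧
      MDifferentiableAt ((𝓘(ℝ, E).prod 𝓘(ℝ, E)).prod (𝓘(ℝ, E).prod 𝓘(ℝ, E))) 𝓘(ℝ, ℝ)
        (exactLagrangian (dupLagrangian L F τ) h Γ)
        (discreteIdentity p) ∧
      (∀ (a A : TangentSpace 𝓘(ℝ, E) p.1) (b B : TangentSpace 𝓘(ℝ, E) p.2),
        differential ((𝓘(ℝ, E).prod 𝓘(ℝ, E)).prod (𝓘(ℝ, E).prod 𝓘(ℝ, E)))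
          (exactLagrangian (dupLagrangian L F τ) h Γ)
          (discreteIdentity p) ((a, A), (b, B)) =
        (D₁ 𝓘(ℝ, E) (exactLagrangian L h γ) p A
            + exactForceMinus F h γ p A
          + D₂ 𝓘(ℝ, E) (exactLagrangian L h γ) p B
            + exactForcePlus F h γ p B)
        - (D₁ 𝓘(ℝ, E) (exactLagrangian L h γ) p a
            + exactForceMinus F h γ p a
          + D₂ 𝓘(ℝ, E) (exactLagrangian L h γ) p b
            + exactForcePlus F h γ p b)) ∧
      -- `K̃_F`, along pairs of solutions of the forced system, generates the exact discrete forces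
      MDifferentiableAt ((𝓘(ℝ, E).prod 𝓘(ℝ, E)).prod (𝓘(ℝ, E).prod 𝓘(ℝ, E))) 𝓘(ℝ, ℝ)
        (pairPotential F τ h γ) (discreteIdentity p) ∧
      (∀ (a A : TangentSpace 𝓘(ℝ, E) p.1) (b B : TangentSpace 𝓘(ℝ, E) p.2),
        differential ((𝓘(ℝ, E).prod 𝓘(ℝ, E)).prod (𝓘(ℝ, E).prod 𝓘(ℝ, E)))
          (pairPotential F τ h γ)
          (discreteIdentity p) ((a, A), (b, B)) =
        (exactForceMinus F h γ p a + exactForcePlus F h γ p b)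
        - (exactForceMinus F h γ p A
            + exactForcePlus F h γ p B)) ∧
      -- `K̃_F`, along the solutions of the duplicated system
      MDifferentiableAt ((𝓘(ℝ, E).prod 𝓘(ℝ, E)).prod (𝓘(ℝ, E).prod 𝓘(ℝ, E))) 𝓘(ℝ, ℝ)
        (exactPotential F τ h Γ) (discreteIdentity p) ∧
      (∀ Δ : TangentSpace ((𝓘(ℝ, E).prod 𝓘(ℝ, E)).prod (𝓘(ℝ, E).prod 𝓘(ℝ, E)))
          (discreteIdentity p),
        differential ((𝓘(ℝ, E).prod 𝓘(ℝ, E)).prod (𝓘(ℝ, E).prod 𝓘(ℝ, E)))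
          (exactPotential F τ h Γ) (discreteIdentity p) Δ =
        ∫ t in (0 : ℝ)..h, F.toModel (velocity h (γ p) t)
          (variationFst 𝓘(ℝ, E) Γ (discreteIdentity p) t Δ
            - variationSnd 𝓘(ℝ, E) Γ (discreteIdentity p) t Δ))) ∧
    -- the discrete equations at the identities are two copies, with opposite signs, of the
    -- forced discrete Euler-Lagrange equations
    (∀ x y z : Q, (x, y) ∈ W → (y, z) ∈ W → ∀ a A : TangentSpace 𝓘(ℝ, E) y,
      freeDEL (𝓘(ℝ, E).prod 𝓘(ℝ, E))
        (exactLagrangian (dupLagrangian L F τ) h Γ)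
        (x, x) (y, y) (z, z) (a, A) =
      forcedDEL (exactLagrangian L h γ)
          (exactForceMinus F h γ) (exactForcePlus F h γ) x y z A
      - forcedDEL (exactLagrangian L h γ)
          (exactForceMinus F h γ) (exactForcePlus F h γ)
          x y z a) ∧
    (∀ (n : ℕ) (q : ℕ → Q), (∀ k < n, (q k, q (k + 1)) ∈ W) →
      ((∀ k, k + 2 ≤ n → ∀ δ : TangentSpace (𝓘(ℝ, E).prod 𝓘(ℝ, E)) (q (k + 1), q (k + 1)),
        freeDEL (𝓘(ℝ, E).prod 𝓘(ℝ, E))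
          (exactLagrangian (dupLagrangian L F τ) h Γ)
          (q k, q k) (q (k + 1), q (k + 1)) (q (k + 2), q (k + 2)) δ = 0) ↔
      (∀ k, k + 2 ≤ n → ∀ δ : TangentSpace 𝓘(ℝ, E) (q (k + 1)),
        forcedDEL (exactLagrangian L h γ)
          (exactForceMinus F h γ) (exactForcePlus F h γ)
          (q k) (q (k + 1)) (q (k + 2)) δ = 0))) := by
  exact mainTheorem9_general L (hL.of_le (by simp)) F hF R hR τ Z U hτ h hh O W γ hγ
    O₂ W₂ Γ hΓ hO₂ hW₂
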